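/- Let $(\bar M,\bar g)$ be a finite-dimensional smooth semi-Riemannian manifold of constant index with Levi-Civita connection $\bar\nabla$, and let $\bar J$ be a smooth $(1,1)$-tensor field with $\bar J^2=3\bar J+I$, $\bar g(X,\bar JY)=\bar g(\bar JX,Y)$ and $\bar\nabla\bar J=0$ (so $(\bar M,\bar g,\bar J)$ is a locally bronze semi-Riemannian manifold). Let $\eta$ be a smooth vector field with $\bar g(\eta,\eta)=1$, put $\theta(X)=\bar g(X,\eta)$, let $l,m$ be smooth functions on $\bar M$ with $(l,m)\neq(0,0)$, and let $\bar\Omega$ be the $(l,m)$-type connection $$\bar\Omega_XY=\bar\nabla_XY+\theta(Y)\{lX+m\bar JX\}.$$ Let $M$ be an $r$-lightlike submanifold of $\bar M$, that is, $\mathrm{Rad}\,TM=TM\cap TM^{\perp}$ is a smooth distribution of rank $r>0$. Fix a screen distribution $S(TM)$ (a smooth complement of $\mathrm{Rad}\,TM$ in $TM$), a screen transversal bundle $S(TM^\perp)$ (a smooth complement of $\mathrm{Rad}\,TM$ in $TM^\perp$), and a lightlike transversal bundle $\mathrm{ltr}(TM)$ (a smooth totally null complement of $\mathrm{Rad}\,TM$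 in $(S(TM)\oplus S(TM^\perp))^\perp$), so that $$T\bar M|_M=\mathrm{Rad}\,TM\oplus S(TM)\oplus \mathrm{ltr}(TM)\oplus S(TM^\perp).$$ Suppose that $M$ is screen generic: $\bar J(\mathrm{Rad}\,TM)=\mathrm{Rad}\,TM$, and $B_o=\bar J(S(TM))\cap S(TM)$ is a smooth nondegenerate distribution. Let $B'$ be the orthogonal complement of $B_o$ in $S(TM)$, again a smooth distribution. For a vector field $X$ on $M$ and a section $V$ of $S(TM)$, let $\Omega_XV$ be the $TM$-component of $\bar\Omega_XV$, let $\Omega^*_XV$ and $\bar h^*(X,V)$ be the components of $\Omega_XV$ in $S(TM)$ and in $\mathrm{Rad}\,TM$, and let $\bar h^s(X,V)$ be the component of $\bar\Omega_XV$ in $S(TM^\perp)$. For $Z$ tangent to $M$ let $fZ$ be the $TM$-component of $\bar JZ$. Then $B_o$ is integrable (that is, $[X,Y]\in\Gamma(B_o)$ for all $X,Y\in\Gamma(B_o)$) if and only if both of the following hold for all $X,Y\in\Gamma(B_o)$, $Z\in\Gamma(B')$ and $N\in\Gamma(\mathrm{ltr}(TM))$: (i) $\bar g(\bar h^*(X,\bar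 JY),\bar JN)+3\,\bar g(\bar h^*(Y,\bar JX),N)=\bar g(\bar h^*(Y,\bar JX),\bar JN)+3\,\bar g(\bar h^*(X,\bar JY),N)$; (ii) $\bar g(\Omega^*_X\bar JY,fZ)+\bar g(\bar h^s(X,\bar JY),\bar JZ)+3\,\bar g(\Omega^*_Y\bar JX,Z)=\bar g(\Omega^*_Y\bar JX,fZ)+\bar g(\bar h^s(Y,\bar JX),\bar JZ)+3\,\bar g(\Omega^*_X\bar JY,Z)$. -/

import Mathlib

open Bundle Set
open scoped Manifold ContDiff

noncomputable section

namespace Bronze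

universe uE uF uN uM

/-! ### Ambient geometry: semi-Riemannian metrics, bronze structures, connections -/

section Ambient

variable (E : Type uE) [NormedAddCommGroup E] [NormedSpace ℝ E]
  (N : Type uN) [TopologicalSpace N] [ChartedSpace E N] [IsManifold 𝓘(ℝ, E) ∞ N]

/-- A smooth semi-Riemannian metric on `N`: a smooth field of symmetric nondegenerate bilinear forms
on the tangent spaces, of constant index. -/
structure SemiRiemannianMetric where
  /-- the bilinear form on each tangent space -/
  val : ∀ p : N, TangentSpace 𝓘(ℝ, E) p →L[ℝ] TangentSpace 𝓘(ℝ, E) p →L[ℝ] ℝ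
  symm : ∀ (p : N) (u v : TangentSpace 𝓘(ℝ, E) p), val p u v = val p v u
  nondegenerate : ∀ (p : N) (u : TangentSpace 𝓘(ℝ, E) p), (∀ v, val p u v = 0) → u = 0
  contMDiff : ContMDiff 𝓘(ℝ, E) (𝓘(ℝ, E).prod 𝓘(ℝ, E →L[ℝ] E →L[ℝ] ℝ)) ∞
    (fun p ↦ TotalSpace.mk' (E →L[ℝ] E →L[ℝ] ℝ) p (val p))
  /-- the index: the maximal dimension of a subspace on which the form is negative definite -/
  index : ℕ
  index_eq : ∀ p : N,
    sigNeg (LinearMap.BilinMap.toQuadraticMap (R := ℝ)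
      (M := TangentSpace 𝓘(ℝ, E) p) (N := ℝ)
      ((ContinuousLinearMap.coeLM ℝ).comp (val p).toLinearMap)) = index

variable {E N}

/-- A `g`-compatible bronze structure: a smooth `(1,1)`-tensor field `J` with `J² = 3J + I` that is
self-adjoint for `g`. -/
structure BronzeStructure (g : SemiRiemannianMetric E N) where
  /-- the endomorphism of each tangent space -/
  val : ∀ p : N, TangentSpace 𝓘(ℝ, E) p →L[ℝ] TangentSpace 𝓘(ℝ, E) p
  contMDiff : ContMDiff 𝓘(ℝ, E) (𝓘(ℝ, E).prod 𝓘(ℝ, E →L[ℝ] E)) ∞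
    (fun p ↦ TotalSpace.mk' (E →L[ℝ] E) p (val p))
  sq : ∀ (p : N) (u : TangentSpace 𝓘(ℝ, E) p), val p (val p u) = (3 : ℝ) • val p u + u
  compatible : ∀ (p : N) (u v : TangentSpace 𝓘(ℝ, E) p), g.val p u (val p v) = g.val p (val p u) v

/-- A linear connection on `N`. Mathlib's argument order is `D Y p v = (D_v Y)(p)`. -/
abbrev LinearConnection (E : Type uE) [NormedAddCommGroup E] [NormedSpace ℝ E]
    (N : Type uN) [TopologicalSpace N] [ChartedSpace E N] [IsManifold 𝓘(ℝ, E) ∞ N] :=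
  CovariantDerivative 𝓘(ℝ, E) E (fun p : N ↦ TangentSpace 𝓘(ℝ, E) p)

/-- `D` is the Levi-Civita connection of `g`: it is torsion free and metric. -/
structure IsLeviCivita [FiniteDimensional ℝ E] (g : SemiRiemannianMetric E N)
    (D : LinearConnection E N) : Prop where
  torsion_free : D.torsion = 0
  metric : ∀ (Y Z : ∀ p : N, TangentSpace 𝓘(ℝ, E) p) (p : N) (v : TangentSpace 𝓘(ℝ, E) p),
    MDifferentiableAt 𝓘(ℝ, E) 𝓘(ℝ, E).tangent
      (fun q ↦ (⟨q, Y q⟩ : TangentBundle 𝓘(ℝ, E) N)) p →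
    MDifferentiableAt 𝓘(ℝ, E) 𝓘(ℝ, E).tangent
      (fun q ↦ (⟨q, Z q⟩ : TangentBundle 𝓘(ℝ, E) N)) p →
    mvfderiv 𝓘(ℝ, E) (fun q ↦ g.val q (Y q) (Z q)) p v
      = g.val p (D Y p v) (Z p) + g.val p (Y p) (D Z p v)

/-- `D J = 0`, that is, `D_v (J Y) = J (D_v Y)`. For the Levi-Civita connection `D` this says that
the bronze semi-Riemannian manifold is locally bronze. -/
def IsParallel {g : SemiRiemannianMetric E N} (D : LinearConnection E N)
    (J : BronzeStructure g) : Prop :=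
  ∀ (Y : ∀ p : N, TangentSpace 𝓘(ℝ, E) p) (p : N) (v : TangentSpace 𝓘(ℝ, E) p),
    MDifferentiableAt 𝓘(ℝ, E) 𝓘(ℝ, E).tangent
      (fun q ↦ (⟨q, Y q⟩ : TangentBundle 𝓘(ℝ, E) N)) p →
    D (fun q ↦ J.val q (Y q)) p v = J.val p (D Y p v)

/-- The connection `Ω_X Y = D_X Y + θ(Y) (l X + m J X)`, where `θ(Y) = g(Y, η)`; it is the
`(l, m)`-type connection determined by `l`, `m`, `η` when `D` is the Levi-Civita connection. -/
def lmConnection (g : SemiRiemannianMetric E N) (J : BronzeStructure g)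
    (D : LinearConnection E N) (η : ∀ p : N, TangentSpace 𝓘(ℝ, E) p) (l m : N → ℝ) :
    LinearConnection E N :=
  D.addOneForm fun p ↦
    (g.val p (η p)).smulRight
      (l p • ContinuousLinearMap.id ℝ (TangentSpace 𝓘(ℝ, E) p) + m p • J.val p)

end Ambient

/-! ### Sections along a map, subbundles, the pulled back connection -/

section Along

variable {E : Type uE} [NormedAddCommGroup E] [NormedSpace ℝ E]
  {N : Type uN} [TopologicalSpace N] [ChartedSpace E N] [IsManifold 𝓘(ℝ, E) ∞ N]
  {F : Type uF} [NormedAddCommGroup F] [NormedSpace ℝ F]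
  {M : Type uM} [TopologicalSpace M] [ChartedSpace F M]

/-- A smooth section of `TN` along `ι : M → N`, over the set `U ⊆ M`. -/
def IsSmoothAlongOn (F : Type uF) [NormedAddCommGroup F] [NormedSpace ℝ F]
    {M : Type uM} [TopologicalSpace M] [ChartedSpace F M] (ι : M → N)
    (V : ∀ x : M, TangentSpace 𝓘(ℝ, E) (ι x)) (U : Set M) : Prop :=
  ContMDiffOn 𝓘(ℝ, F) 𝓘(ℝ, E).tangent ∞
    (fun x ↦ (⟨ι x, V x⟩ : TangentBundle 𝓘(ℝ, E) N)) U

/-- A family of subspaces of the spaces `T_{ι x} N` is a smooth subbundle of rank `k` of `TN`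
along `ι` if it has local smooth frames with `k` elements. -/
def IsSubbundleAlong (F : Type uF) [NormedAddCommGroup F] [NormedSpace ℝ F]
    {M : Type uM} [TopologicalSpace M] [ChartedSpace F M] (ι : M → N) (k : ℕ)
    (D : ∀ x : M, Submodule ℝ (TangentSpace 𝓘(ℝ, E) (ι x))) : Prop :=
  ∀ x₀ : M, ∃ U : Set M, IsOpen U ∧ x₀ ∈ U ∧
    ∃ s : Fin k → ∀ x : M, TangentSpace 𝓘(ℝ, E) (ι x),
      (∀ i, IsSmoothAlongOn F ι (s i) U) ∧
      ∀ x ∈ U, LinearIndependent ℝ (fun i ↦ s i x) ∧ Submodule.span ℝ (range fun i ↦ s i x) = D x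

/-- `V ∈ Γ(D)`, for a family `D` of subspaces of the spaces `T_{ι x} N`. -/
def IsSection (F : Type uF) [NormedAddCommGroup F] [NormedSpace ℝ F]
    {M : Type uM} [TopologicalSpace M] [ChartedSpace F M] (ι : M → N)
    (D : ∀ x : M, Submodule ℝ (TangentSpace 𝓘(ℝ, E) (ι x)))
    (V : ∀ x : M, TangentSpace 𝓘(ℝ, E) (ι x)) : Prop :=
  IsSmoothAlongOn F ι V univ ∧ ∀ x, V x ∈ D x

/-- The vector field `X` on `M`, seen as a section of `TN` along `ι`. -/
def push (E : Type uE) [NormedAddCommGroup E] [NormedSpace ℝ E]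
    {N : Type uN} [TopologicalSpace N] [ChartedSpace E N] (ι : M → N)
    (X : ∀ x : M, TangentSpace 𝓘(ℝ, F) x) (x : M) : TangentSpace 𝓘(ℝ, E) (ι x) :=
  mfderiv 𝓘(ℝ, F) 𝓘(ℝ, E) ι x (X x)

/-- `J X`, for a vector field `X` on `M`, as a section of `TN` along `ι`. -/
def pushJ {g : SemiRiemannianMetric E N} (J : BronzeStructure g) (ι : M → N)
    (X : ∀ x : M, TangentSpace 𝓘(ℝ, F) x) (x : M) : TangentSpace 𝓘(ℝ, E) (ι x) :=
  J.val (ι x) (push E ι X x)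

/-- `X` is a smooth vector field on `M` that takes its values in the distribution `D`. -/
def IsTangentSection [IsManifold 𝓘(ℝ, F) ∞ M] (ι : M → N) (D : ∀ x : M, Submodule ℝ (TangentSpace 𝓘(ℝ, E) (ι x)))
    (X : ∀ x : M, TangentSpace 𝓘(ℝ, F) x) : Prop :=
  ContMDiff 𝓘(ℝ, F) 𝓘(ℝ, F).tangent ∞ (fun x ↦ (⟨x, X x⟩ : TangentBundle 𝓘(ℝ, F) M)) ∧
    ∀ x, push E ι X x ∈ D x

/-- A distribution on `M` is integrable if `[X, Y] ∈ Γ(D)` for all `X, Y ∈ Γ(D)`. -/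
def IsIntegrable (F : Type uF) [NormedAddCommGroup F] [NormedSpace ℝ F]
    {M : Type uM} [TopologicalSpace M] [ChartedSpace F M] [IsManifold 𝓘(ℝ, F) ∞ M]
    (ι : M → N)
    (D : ∀ x : M, Submodule ℝ (TangentSpace 𝓘(ℝ, E) (ι x))) : Prop :=
  ∀ X Y : ∀ x : M, TangentSpace 𝓘(ℝ, F) x, IsTangentSection ι D X → IsTangentSection ι D Y →
    ∀ x, push E ι (VectorField.mlieBracket 𝓘(ℝ, F) X Y) x ∈ D x

/-- The covariant derivative `D_v V` of a section `V` of `TN` along `ι`, in the direction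
`v ∈ T_x M`, for a connection `D` on `N`: if `V = ∑ Vⁱ (eᵢ ∘ ι)` near `x`, for the coordinate
frame `eᵢ` at `ι x`, then `D_v V = ∑ (dVⁱ(v) eᵢ + Vⁱ D_{dι v} eᵢ)`. -/
def covAlong [FiniteDimensional ℝ E] (D : LinearConnection E N) (ι : M → N)
    (V : ∀ x : M, TangentSpace 𝓘(ℝ, E) (ι x)) (x : M) (v : TangentSpace 𝓘(ℝ, F) x) :
    TangentSpace 𝓘(ℝ, E) (ι x) :=
  let e := trivializationAt E (fun p : N ↦ TangentSpace 𝓘(ℝ, E) p) (ι x)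
  let b := Module.finBasis ℝ E
  ∑ i, (mvfderiv 𝓘(ℝ, F) (fun y ↦ e.localFrameCoeff 𝓘(ℝ, E) b i (ι y) (V y)) x v
          • e.localFrame b i (ι x)
      + e.localFrameCoeff 𝓘(ℝ, E) b i (ι x) (V x)
          • D (e.localFrame b i) (ι x) (mfderiv 𝓘(ℝ, F) 𝓘(ℝ, E) ι x v))

end Along

/-! ### Lightlike submanifolds -/

section Lightlike

variable {E : Type uE} [NormedAddCommGroup E] [NormedSpace ℝ E]
  {N : Type uN} [TopologicalSpace N] [ChartedSpace E N] [IsManifold 𝓘(ℝ, E) ∞ N]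
  {F : Type uF} [NormedAddCommGroup F] [NormedSpace ℝ F]
  {M : Type uM} [TopologicalSpace M] [ChartedSpace F M]

/-- The `g`-orthogonal complement of a subspace of a tangent space. -/
def orth (g : SemiRiemannianMetric E N) {p : N} (D : Submodule ℝ (TangentSpace 𝓘(ℝ, E) p)) :
    Submodule ℝ (TangentSpace 𝓘(ℝ, E) p) where
  carrier := {v | ∀ u ∈ D, g.val p u v = 0}
  add_mem' := fun ha hb u hu ↦ by simp [ha u hu, hb u hu]
  zero_mem' := fun u _ ↦ by simp
  smul_mem' := fun c a ha u hu ↦ by simp [ha u hu]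

/-- The tangent space of `M` at `x`, inside `T_{ι x} N`. -/
def tangent (E : Type uE) [NormedAddCommGroup E] [NormedSpace ℝ E]
    {N : Type uN} [TopologicalSpace N] [ChartedSpace E N]
    (F : Type uF) [NormedAddCommGroup F] [NormedSpace ℝ F]
    {M : Type uM} [TopologicalSpace M] [ChartedSpace F M] (ι : M → N) (x : M) :
    Submodule ℝ (TangentSpace 𝓘(ℝ, E) (ι x)) :=
  LinearMap.range (mfderiv 𝓘(ℝ, F) 𝓘(ℝ, E) ι x).toLinearMap

/-- The radical space `Rad T_x M = T_x M ∩ (T_x M)^⊥`. -/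
def radical (F : Type uF) [NormedAddCommGroup F] [NormedSpace ℝ F]
    {M : Type uM} [TopologicalSpace M] [ChartedSpace F M]
    (g : SemiRiemannianMetric E N) (ι : M → N) (x : M) :
    Submodule ℝ (TangentSpace 𝓘(ℝ, E) (ι x)) :=
  tangent E F ι x ⊓ orth g (tangent E F ι x)

/-- An `r`-lightlike submanifold `(M, g, S(TM), S(TM^⊥))` of `(N, g)`, immersed by `ι`, with a
choice of lightlike transversal bundle `ltr(TM)`. -/
structure LightlikeSubmanifold (F : Type uF) [NormedAddCommGroup F] [NormedSpace ℝ F]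
    {M : Type uM} [TopologicalSpace M] [ChartedSpace F M]
    (g : SemiRiemannianMetric E N) (ι : M → N) where
  isImmersion : Manifold.IsImmersion 𝓘(ℝ, F) 𝓘(ℝ, E) ∞ ι
  /-- the rank of the radical distribution -/
  r : ℕ
  r_pos : 0 < r
  radical_subbundle : IsSubbundleAlong F ι r (radical F g ι)
  /-- the screen distribution `S(TM)`, a complement of `Rad TM` in `TM` -/
  screen : ∀ x : M, Submodule ℝ (TangentSpace 𝓘(ℝ, E) (ι x))
  screen_subbundle : ∃ k, IsSubbundleAlong F ι k screen
  screen_inf : ∀ x, radical F g ι x ⊓ screen x = ⊥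
  screen_sup : ∀ x, radical F g ι x ⊔ screen x = tangent E F ι x
  /-- the screen transversal bundle `S(TM^⊥)`, a complement of `Rad TM` in `TM^⊥` -/
  screenTrans : ∀ x : M, Submodule ℝ (TangentSpace 𝓘(ℝ, E) (ι x))
  screenTrans_subbundle : ∃ k, IsSubbundleAlong F ι k screenTrans
  screenTrans_inf : ∀ x, radical F g ι x ⊓ screenTrans x = ⊥
  screenTrans_sup : ∀ x, radical F g ι x ⊔ screenTrans x = orth g (tangent E F ι x)
  /-- the lightlike transversal bundle `ltr(TM)`: a totally null complement of `Rad TM` in the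
  orthogonal complement of `S(TM) ⊕ S(TM^⊥)` -/
  ltr : ∀ x : M, Submodule ℝ (TangentSpace 𝓘(ℝ, E) (ι x))
  ltr_subbundle : IsSubbundleAlong F ι r ltr
  ltr_inf : ∀ x, radical F g ι x ⊓ ltr x = ⊥
  ltr_sup : ∀ x, radical F g ι x ⊔ ltr x = orth g (screen x ⊔ screenTrans x)
  ltr_null : ∀ x, ∀ u ∈ ltr x, ∀ v ∈ ltr x, g.val (ι x) u v = 0
  /-- `TN|_M = TM ⊕ tr(TM)`, where `tr(TM) = ltr(TM) ⊕ S(TM^⊥)` -/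
  isCompl_tangent : ∀ x, IsCompl (tangent E F ι x) (ltr x ⊔ screenTrans x)

namespace LightlikeSubmanifold

variable {g : SemiRiemannianMetric E N} {ι : M → N} (S : LightlikeSubmanifold F g ι) (x : M)

theorem disjoint_ltr_screenTrans : Disjoint (S.ltr x) (S.screenTrans x) := by
  rw [Submodule.disjoint_def]
  intro u hu hu'
  have hT : u ∈ orth g (tangent E F ι x) := by
    rw [← S.screenTrans_sup x]; exact Submodule.mem_sup_right hu'
  have hL : u ∈ orth g (S.screen x ⊔ S.screenTrans x) := by
    rw [← S.ltr_sup x]; exact Submodule.mem_sup_right hu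
  have htop : (⊤ : Submodule ℝ (TangentSpace 𝓘(ℝ, E) (ι x))) ≤ orth g (Submodule.span ℝ {u}) := by
    rw [← (S.isCompl_tangent x).sup_eq_top]
    have key : ∀ v, g.val (ι x) u v = 0 → v ∈ orth g (Submodule.span ℝ {u}) := by
      intro v hv w hw
      obtain ⟨c, rfl⟩ := Submodule.mem_span_singleton.mp hw
      simp [hv]
    refine sup_le (fun v hv ↦ key v ?_) (sup_le (fun v hv ↦ key v ?_) (fun v hv ↦ key v ?_))
    · rw [g.symm]; exact hT v hv
    · exact S.ltr_null x u hu v hv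
    · rw [g.symm]; exact hL v (Submodule.mem_sup_right hv)
  refine g.nondegenerate (ι x) u fun v ↦ ?_
  exact htop (Submodule.mem_top : v ∈ ⊤) u (Submodule.mem_span_singleton_self u)

theorem isCompl_screenTrans : IsCompl (S.screenTrans x) (tangent E F ι x ⊔ S.ltr x) :=
  (((S.disjoint_ltr_screenTrans x).isCompl_sup_left_of_isCompl_sup_right
    (S.isCompl_tangent x))).symm

theorem isCompl_screen : IsCompl (S.screen x)
    (radical F g ι x ⊔ (S.ltr x ⊔ S.screenTrans x)) := by
  have h := S.isCompl_tangent x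
  rw [← S.screen_sup x, sup_comm] at h
  exact (disjoint_iff.mpr (S.screen_inf x)).symm.isCompl_sup_right_of_isCompl_sup_left h

theorem isCompl_radical : IsCompl (radical F g ι x)
    (S.screen x ⊔ (S.ltr x ⊔ S.screenTrans x)) := by
  have h := S.isCompl_tangent x
  rw [← S.screen_sup x] at h
  exact (disjoint_iff.mpr (S.screen_inf x)).isCompl_sup_right_of_isCompl_sup_left h

/-- The projection of `TN|_M = Rad TM ⊕ S(TM) ⊕ ltr(TM) ⊕ S(TM^⊥)` onto `TM = Rad TM ⊕ S(TM)`,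
along `tr(TM) = ltr(TM) ⊕ S(TM^⊥)`. -/
def tangentPart : TangentSpace 𝓘(ℝ, E) (ι x) →ₗ[ℝ] TangentSpace 𝓘(ℝ, E) (ι x) :=
  (tangent E F ι x).projection _ (S.isCompl_tangent x)

/-- The projection onto `Rad TM`, along the sum of the other summands of `TN|_M`. -/
def radicalPart : TangentSpace 𝓘(ℝ, E) (ι x) →ₗ[ℝ] TangentSpace 𝓘(ℝ, E) (ι x) :=
  (radical F g ι x).projection _ (S.isCompl_radical x)

/-- The projection onto `S(TM)`, along the sum of the other summands of `TN|_M`. -/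
def screenPart : TangentSpace 𝓘(ℝ, E) (ι x) →ₗ[ℝ] TangentSpace 𝓘(ℝ, E) (ι x) :=
  (S.screen x).projection _ (S.isCompl_screen x)

/-- The projection onto `S(TM^⊥)`, along the sum of the other summands of `TN|_M`. -/
def screenTransPart : TangentSpace 𝓘(ℝ, E) (ι x) →ₗ[ℝ] TangentSpace 𝓘(ℝ, E) (ι x) :=
  (S.screenTrans x).projection _ (S.isCompl_screenTrans x)

/-- The tangential part `f v` of `J v`. -/
def f (J : BronzeStructure g) (v : TangentSpace 𝓘(ℝ, E) (ι x)) : TangentSpace 𝓘(ℝ, E) (ι x) :=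
  S.tangentPart x (J.val (ι x) v)

variable [FiniteDimensional ℝ E] (Ω : LinearConnection E N)
  (X : ∀ x : M, TangentSpace 𝓘(ℝ, F) x) (V : ∀ x : M, TangentSpace 𝓘(ℝ, E) (ι x))

/-- The connection on `M` induced by a connection `Ω` of `N`: the tangential part of `Ω_X V`. -/
def inducedConnection : TangentSpace 𝓘(ℝ, E) (ι x) :=
  S.tangentPart x (covAlong Ω ι V x (X x))

/-- The screen second fundamental form `h^s(X, V)`: the `S(TM^⊥)`-part of `Ω_X V`. -/
def screenSecondForm : TangentSpace 𝓘(ℝ, E) (ι x) :=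
  S.screenTransPart x (covAlong Ω ι V x (X x))

/-- The connection `Ω^*_X V`, for `V` in `S(TM)`: the `S(TM)`-part of the induced connection. -/
def screenConnection : TangentSpace 𝓘(ℝ, E) (ι x) :=
  S.screenPart x (S.inducedConnection x Ω X V)

/-- The form `h^*(X, V)`, for `V` in `S(TM)`: the `Rad TM`-part of the induced connection. -/
def radicalForm : TangentSpace 𝓘(ℝ, E) (ι x) :=
  S.radicalPart x (S.inducedConnection x Ω X V)

end LightlikeSubmanifold

/-- The distribution `B₀ = J(S(TM)) ∩ S(TM)`. -/
def LightlikeSubmanifold.B₀ {g : SemiRiemannianMetric E N} {ι : M → N}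
    (S : LightlikeSubmanifold F g ι) (J : BronzeStructure g) (x : M) :
    Submodule ℝ (TangentSpace 𝓘(ℝ, E) (ι x)) :=
  (S.screen x).map (J.val (ι x)).toLinearMap ⊓ S.screen x

/-- A screen generic lightlike submanifold: `Rad TM` is `J`-invariant, and
`B₀ = J(S(TM)) ∩ S(TM)` is a nondegenerate distribution; `B'` is its orthogonal complement
in `S(TM)`. -/
structure ScreenGenericLightlikeSubmanifold (F : Type uF) [NormedAddCommGroup F] [NormedSpace ℝ F]
    {M : Type uM} [TopologicalSpace M] [ChartedSpace F M]
    (g : SemiRiemannianMetric E N) (J : BronzeStructure g) (ι : M → N)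
    extends LightlikeSubmanifold F g ι where
  radical_invariant : ∀ x, (radical F g ι x).map (J.val (ι x)).toLinearMap = radical F g ι x
  B₀_subbundle : ∃ k, IsSubbundleAlong F ι k (toLightlikeSubmanifold.B₀ J)
  B₀_nondegenerate : ∀ x, toLightlikeSubmanifold.B₀ J x ⊓ orth g (toLightlikeSubmanifold.B₀ J x) = ⊥
  /-- the complementary distribution `B'` -/
  Bprime : ∀ x : M, Submodule ℝ (TangentSpace 𝓘(ℝ, E) (ι x))
  Bprime_subbundle : ∃ k, IsSubbundleAlong F ι k Bprime
  Bprime_eq : ∀ x, Bprime x = screen x ⊓ orth g (toLightlikeSubmanifold.B₀ J x)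

end Lightlike

end Bronze

end

/-
Since `D` is torsion-free and `J` is parallel, `Ω_X (J Y) - Ω_Y (J X) = J [X, Y] + β` for all
`X, Y ∈ Γ(B₀)`, where `β` is a section of `B₀`: the terms of `Ω` in `l` and `m` are combinations of
`X`, `Y`, `J X`, `J Y`, and `B₀` is `J`-invariant. So both conditions are conditions on the parts
of `w = J v + β`, for `v = [X, Y]` tangent to `M`, and `v` is recovered with `J⁻¹ = J - 3`.

The vector `w` is orthogonal to `Rad TM`, hence `w = a + s + t` with `a`, `s`, `t` in `Rad TM`,
`S(TM)`, `S(TM^⊥)`. The difference of the two sides of (i) is `g(J a - 3 a, N)`; as `Rad TM` is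
`J`-invariant and dually paired with `ltr(TM)`, (i) says `a = 0`. The difference of the two sides
of (ii) is `g(w, J Z - 3 Z) = g(v, Z)`, so (ii) says `v ⟂ B'`, which puts the `S(TM)`-part of `v`
in `B₀`, as `B₀` is nondegenerate; then `a` is `J` of the `Rad TM`-part of `v`. Together they say
`v ∈ B₀`. Both conditions are pointwise because vectors of a subbundle extend to global sections.
-/

noncomputable section

namespace Bronze

open scoped Topology

section Commutator

variable {F : Type*} [NormedAddCommGroup F] [NormedSpace ℝ F]
  {G : Type*} [NormedAddCommGroup G] [NormedSpace ℝ G]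
  {M : Type*} [TopologicalSpace M] [ChartedSpace F M]

theorem fderiv_apply_sub_fderiv_apply_eq_fderiv_lieBracket {f : F → G} {X Y : F → F} {z : F}
    (hf : ContDiffAt ℝ 2 f z) (hX : DifferentiableAt ℝ X z) (hY : DifferentiableAt ℝ Y z) :
    fderiv ℝ (fun w ↦ fderiv ℝ f w (Y w)) z (X z) - fderiv ℝ (fun w ↦ fderiv ℝ f w (X w)) z (Y z)
      = fderiv ℝ f z (VectorField.lieBracket ℝ X Y z) := by
  have hf' : DifferentiableAt ℝ (fderiv ℝ f) z :=
    (hf.fderiv_right (m := 1) (by norm_num)).differentiableAt (by norm_num)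
  have hsymm : IsSymmSndFDerivAt ℝ f z := hf.isSymmSndFDerivAt (by simp)
  rw [fderiv_clm_apply hf' hY, fderiv_clm_apply hf' hX]
  simp [VectorField.lieBracket, hsymm.eq (X z) (Y z)]

/-- The expression of a vector field on `M` in the chart at `x`, a vector field on the model
space. -/
def inChart (x : M) (V : ∀ y : M, TangentSpace 𝓘(ℝ, F) y) : F → F :=
  VectorField.mpullbackWithin 𝓘(ℝ, F) 𝓘(ℝ, F) (extChartAt 𝓘(ℝ, F) x).symm V (range 𝓘(ℝ, F))

theorem mvfderiv_apply_eq_fderiv_inChart [IsManifold 𝓘(ℝ, F) 1 M] {f : M → G}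
    (V : ∀ y : M, TangentSpace 𝓘(ℝ, F) y) {x y : M} (hy : y ∈ (extChartAt 𝓘(ℝ, F) x).source)
    (hf : MDiffAt f y) :
    d% f y (V y) = fderiv ℝ (f ∘ (extChartAt 𝓘(ℝ, F) x).symm) (extChartAt 𝓘(ℝ, F) x y)
      (inChart x V (extChartAt 𝓘(ℝ, F) x y)) := by
  obtain ⟨z, hz, rfl⟩ : ∃ z ∈ (extChartAt 𝓘(ℝ, F) x).target, (extChartAt 𝓘(ℝ, F) x).symm z = y :=
    ⟨_, (extChartAt 𝓘(ℝ, F) x).map_source hy, (extChartAt 𝓘(ℝ, F) x).left_inv hy⟩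
  have hinv := isInvertible_mfderivWithin_extChartAt_symm (I := 𝓘(ℝ, F)) hz
  have hdiff := mdifferentiableWithinAt_extChartAt_symm (I := 𝓘(ℝ, F)) hz
  rw [(extChartAt 𝓘(ℝ, F) x).right_inv hz, inChart, VectorField.mpullbackWithin_apply]
  rw [modelWithCornersSelf_coe, range_id, mfderivWithin_univ] at hinv ⊢
  rw [modelWithCornersSelf_coe, range_id, mdifferentiableWithinAt_univ] at hdiff
  rw [← mfderiv_eq_fderiv]
  exact ((mfderiv_comp_apply z hf hdiff _).trans
    (congrArg _ (hinv.self_apply_inverse (V _)))).symm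

theorem inChart_extChartAt [IsManifold 𝓘(ℝ, F) 1 M] (x : M)
    (V : ∀ y : M, TangentSpace 𝓘(ℝ, F) y) : inChart x V (extChartAt 𝓘(ℝ, F) x x) = V x := by
  have hy := (extChartAt_to_inv (I := 𝓘(ℝ, F)) x).symm
  rw [inChart, VectorField.mpullbackWithin_apply]
  generalize (extChartAt 𝓘(ℝ, F) x).symm (extChartAt 𝓘(ℝ, F) x x) = y at *
  subst hy
  exact mfderivWithin_extChartAt_symm_inverse_apply (I := 𝓘(ℝ, F)) (V _)

theorem mvfderiv_congr {f₁ f₂ : M → G} {x : M} (h : f₁ =ᶠ[𝓝 x] f₂) : d% f₁ x = d% f₂ x :=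
  h.mfderiv_eq

theorem mvfderiv_comp_extChartAt [IsManifold 𝓘(ℝ, F) 1 M] {f : F → G} {x : M}
    (hf : DifferentiableAt ℝ f (extChartAt 𝓘(ℝ, F) x x)) :
    d% (f ∘ extChartAt 𝓘(ℝ, F) x) x = fderiv ℝ f (extChartAt 𝓘(ℝ, F) x x) := by
  refine (mfderiv_comp x hf.mdifferentiableAt
    (mdifferentiableAt_extChartAt (mem_chart_source F x))).trans ?_
  rw [mfderiv_extChartAt_self, mfderiv_eq_fderiv]
  exact ContinuousLinearMap.comp_id _

theorem mvfderiv_apply_eventuallyEq [IsManifold 𝓘(ℝ, F) 1 M] {f : M → G} {x : M}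
    (V : ∀ y : M, TangentSpace 𝓘(ℝ, F) y) (hf : CMDiffAt 1 f x) :
    (fun y ↦ d% f y (V y)) =ᶠ[𝓝 x]
      (fun z ↦ fderiv ℝ (f ∘ (extChartAt 𝓘(ℝ, F) x).symm) z (inChart x V z))
        ∘ extChartAt 𝓘(ℝ, F) x := by
  filter_upwards [extChartAt_source_mem_nhds (I := 𝓘(ℝ, F)) x,
    (contMDiffAt_iff_contMDiffAt_nhds (by simp)).1 hf] with y hy hfy
  exact mvfderiv_apply_eq_fderiv_inChart V hy (hfy.mdifferentiableAt one_ne_zero)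

theorem contDiffAt_comp_extChartAt_symm {f : M → G} {x : M} {n : ℕ∞ω} (hf : CMDiffAt n f x) :
    ContDiffAt ℝ n (f ∘ (extChartAt 𝓘(ℝ, F) x).symm) (extChartAt 𝓘(ℝ, F) x x) := by
  have h := (contMDiffAt_iff.1 hf).2
  rwa [modelWithCornersSelf_coe, range_id, contDiffWithinAt_univ] at h

theorem inChart_mlieBracket_extChartAt [IsManifold 𝓘(ℝ, F) 1 M] (x : M)
    (X Y : ∀ y : M, TangentSpace 𝓘(ℝ, F) y) :
    inChart x (VectorField.mlieBracket 𝓘(ℝ, F) X Y) (extChartAt 𝓘(ℝ, F) x x)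
      = VectorField.lieBracket ℝ (inChart x X) (inChart x Y) (extChartAt 𝓘(ℝ, F) x x) := by
  rw [inChart_extChartAt, ← VectorField.lieBracketWithin_univ, inChart, inChart,
    ← VectorField.mlieBracketWithin_univ, VectorField.mlieBracketWithin_apply,
    mfderiv_extChartAt_self, preimage_univ, univ_inter, modelWithCornersSelf_coe, range_id]
  exact congrArg (fun A : F →L[ℝ] F ↦ A _) ContinuousLinearMap.inverse_id

variable [IsManifold 𝓘(ℝ, F) 2 M] [CompleteSpace F] {X Y : ∀ x : M, TangentSpace 𝓘(ℝ, F) x} {x : M}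

theorem differentiableAt_inChart (hX : MDiffAt (T% X) x) :
    DifferentiableAt ℝ (inChart x X) (extChartAt 𝓘(ℝ, F) x x) :=
  (MDifferentiableWithinAt.differentiableWithinAt_mpullbackWithin_vectorField
    (mdifferentiableWithinAt_univ.2 hX)).differentiableAt (by simp)

theorem differentiableAt_fderiv_inChart {f : M → G} (hf : CMDiffAt 2 f x)
    (hX : MDiffAt (T% X) x) :
    DifferentiableAt ℝ (fun z ↦ fderiv ℝ (f ∘ (extChartAt 𝓘(ℝ, F) x).symm) z (inChart x X z))
      (extChartAt 𝓘(ℝ, F) x x) :=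
  (((contDiffAt_comp_extChartAt_symm hf).fderiv_right (m := 1) (by norm_num)).differentiableAt
    one_ne_zero).clm_apply (differentiableAt_inChart hX)

theorem mvfderiv_mvfderiv_sub {f : M → G} (hf : CMDiffAt 2 f x) (hX : MDiffAt (T% X) x)
    (hY : MDiffAt (T% Y) x) :
    d% (fun y ↦ d% f y (Y y)) x (X x) - d% (fun y ↦ d% f y (X y)) x (Y x)
      = d% f x (VectorField.mlieBracket 𝓘(ℝ, F) X Y x) := by
  have : IsManifold 𝓘(ℝ, F) 1 M := .of_le one_le_two
  have iterated : ∀ {V W : ∀ x : M, TangentSpace 𝓘(ℝ, F) x}, MDiffAt (T% W) x →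
      d% (fun y ↦ d% f y (W y)) x (V x)
        = fderiv ℝ (fun z ↦ fderiv ℝ (f ∘ (extChartAt 𝓘(ℝ, F) x).symm) z (inChart x W z))
          (extChartAt 𝓘(ℝ, F) x x) (inChart x V (extChartAt 𝓘(ℝ, F) x x)) := by
    intro V W hW
    rw [mvfderiv_congr (mvfderiv_apply_eventuallyEq W (hf.of_le one_le_two)),
      mvfderiv_comp_extChartAt (differentiableAt_fderiv_inChart hf hW), inChart_extChartAt]
    rfl
  rw [iterated hY, iterated hX, mvfderiv_apply_eq_fderiv_inChart _ (mem_extChartAt_source x)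
    (hf.mdifferentiableAt two_ne_zero), inChart_mlieBracket_extChartAt]
  exact fderiv_apply_sub_fderiv_apply_eq_fderiv_lieBracket (contDiffAt_comp_extChartAt_symm hf)
    (differentiableAt_inChart hX) (differentiableAt_inChart hY)

end Commutator

section CoordinateFrame

variable {E : Type*} [NormedAddCommGroup E] [NormedSpace ℝ E] [FiniteDimensional ℝ E]
  {N : Type*} [TopologicalSpace N] [ChartedSpace E N] [IsManifold 𝓘(ℝ, E) ∞ N]

/-- The local frame of `TN` given by the chart at `p₀` and a fixed basis of the model space. -/
def coordFrame (p₀ : N) (i : Fin (Module.finrank ℝ E)) (p : N) : TangentSpace 𝓘(ℝ, E) p :=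
  (trivializationAt E (fun p : N ↦ TangentSpace 𝓘(ℝ, E) p) p₀).localFrame
    (Module.finBasis ℝ E) i p

/-- The coefficients of tangent vectors in the frame `coordFrame p₀`; they are `0` outside of the
chart domain. -/
def coordCoeff (p₀ : N) (i : Fin (Module.finrank ℝ E)) (p : N) :
    TangentSpace 𝓘(ℝ, E) p →ₗ[ℝ] ℝ :=
  (trivializationAt E (fun p : N ↦ TangentSpace 𝓘(ℝ, E) p) p₀).localFrameCoeff 𝓘(ℝ, E)
    (Module.finBasis ℝ E) i p

/-- The coordinate functions of the chart at `p₀`, in the basis used for `coordFrame`. -/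
def chartCoord (p₀ : N) (i : Fin (Module.finrank ℝ E)) (p : N) : ℝ :=
  (Module.finBasis ℝ E).repr (extChartAt 𝓘(ℝ, E) p₀ p) i

variable {p₀ p : N} {i j : Fin (Module.finrank ℝ E)}

theorem coordCoeff_apply (hp : p ∈ (chartAt E p₀).source) (v : TangentSpace 𝓘(ℝ, E) p) :
    coordCoeff p₀ i p v
      = (Module.finBasis ℝ E).repr
        (trivializationAt E (fun p : N ↦ TangentSpace 𝓘(ℝ, E) p) p₀ ⟨p, v⟩).2 i := by
  classical
  have h := (trivializationAt E (fun p : N ↦ TangentSpace 𝓘(ℝ, E) p) p₀).localFrameCoeff_eq_coeff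
    (I := 𝓘(ℝ, E)) (b := Module.finBasis ℝ E) (i := i)
    (s := Function.update (fun q : N ↦ (0 : TangentSpace 𝓘(ℝ, E) q)) p v) (by simpa using hp)
  simpa [coordCoeff] using h

theorem sum_coordCoeff_smul (hp : p ∈ (chartAt E p₀).source) (v : TangentSpace 𝓘(ℝ, E) p) :
    ∑ i, coordCoeff p₀ i p v • coordFrame p₀ i p = v := by
  classical
  have h := (trivializationAt E
    (fun p : N ↦ TangentSpace 𝓘(ℝ, E) p) p₀).eq_sum_localFrameCoeff_smul
    (I := 𝓘(ℝ, E)) (b := Module.finBasis ℝ E)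
    (s := Function.update (fun q : N ↦ (0 : TangentSpace 𝓘(ℝ, E) q)) p v) (by simpa using hp)
  simpa [coordCoeff, coordFrame] using h.symm

theorem coordCoeff_coordFrame (hp : p ∈ (chartAt E p₀).source) :
    coordCoeff p₀ i p (coordFrame p₀ j p) = if j = i then 1 else 0 := by
  have hp' : p ∈ (trivializationAt E (fun p : N ↦ TangentSpace 𝓘(ℝ, E) p) p₀).baseSet := by
    simpa using hp
  rw [coordCoeff, Trivialization.localFrameCoeff_apply_of_mem_baseSet _ _ hp' (coordFrame p₀ j) i,
    coordFrame, Trivialization.localFrame_apply_of_mem_baseSet _ _ hp', Module.Basis.repr_self,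
    Finsupp.single_apply]

theorem contMDiffAt_coordFrame (hp : p ∈ (chartAt E p₀).source) :
    CMDiffAt ∞ (T% (coordFrame p₀ i)) p :=
  contMDiffAt_localFrame_of_mem (n := ∞) _ (Module.finBasis ℝ E) i (by simpa using hp)

theorem mdifferentiableAt_coordFrame (hp : p ∈ (chartAt E p₀).source) :
    MDiffAt (T% (coordFrame p₀ i)) p :=
  (contMDiffAt_coordFrame hp).mdifferentiableAt (by simp)

theorem contMDiffAt_chartCoord (hp : p ∈ (chartAt E p₀).source) :
    CMDiffAt ∞ (chartCoord p₀ i) p :=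
  ((Module.finBasis ℝ E).coord i).toContinuousLinearMap.contMDiff.contMDiffAt.comp p
    (contMDiffAt_extChartAt' hp)

theorem coordCoeff_eq_mvfderiv_chartCoord (hp : p ∈ (chartAt E p₀).source)
    (v : TangentSpace 𝓘(ℝ, E) p) : coordCoeff p₀ i p v = d% (chartCoord p₀ i) p v := by
  have hp' : p ∈ (trivializationAt E (fun p : N ↦ TangentSpace 𝓘(ℝ, E) p) p₀).baseSet := by
    simpa using hp
  have hcomp := mfderiv_comp p (I := 𝓘(ℝ, E)) (I' := 𝓘(ℝ, E)) (I'' := 𝓘(ℝ))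
    (((Module.finBasis ℝ E).coord i).toContinuousLinearMap.mdifferentiableAt)
    (mdifferentiableAt_extChartAt (I := 𝓘(ℝ, E)) hp)
  rw [ContinuousLinearMap.mfderiv_eq,
    ← TangentBundle.continuousLinearMapAt_trivializationAt (I := 𝓘(ℝ, E)) hp] at hcomp
  refine (coordCoeff_apply hp v).trans (Eq.trans ?_ (DFunLike.congr_fun hcomp v).symm)
  change _ = (Module.finBasis ℝ E).repr
    ((trivializationAt E (TangentSpace 𝓘(ℝ, E)) p₀).continuousLinearMapAt ℝ p v) i
  rw [Trivialization.continuousLinearMapAt_apply, Trivialization.linearMapAt_apply, if_pos hp']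

theorem mvfderiv_mvfderiv_chartCoord_coordFrame (hp : p ∈ (chartAt E p₀).source) :
    d% (fun q ↦ d% (chartCoord p₀ i) q (coordFrame p₀ j q)) p = 0 := by
  have hconst : (fun q ↦ d% (chartCoord p₀ i) q (coordFrame p₀ j q)) =ᶠ[𝓝 p]
      fun _ ↦ if j = i then 1 else 0 := by
    filter_upwards [(chartAt E p₀).open_source.mem_nhds hp] with q hq
    rw [← coordCoeff_eq_mvfderiv_chartCoord hq, coordCoeff_coordFrame hq]
  rw [mvfderiv_congr hconst, mvfderiv_const]

theorem mlieBracket_coordFrame (hp : p ∈ (chartAt E p₀).source) :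
    VectorField.mlieBracket 𝓘(ℝ, E) (coordFrame p₀ i) (coordFrame p₀ j) p = 0 := by
  rw [← sum_coordCoeff_smul hp (VectorField.mlieBracket _ _ _ p)]
  refine Finset.sum_eq_zero fun k _ ↦ ?_
  rw [coordCoeff_eq_mvfderiv_chartCoord hp, ← mvfderiv_mvfderiv_sub
    ((contMDiffAt_chartCoord hp).of_le ENat.LEInfty.out) (mdifferentiableAt_coordFrame hp)
    (mdifferentiableAt_coordFrame hp), mvfderiv_mvfderiv_chartCoord_coordFrame hp,
    mvfderiv_mvfderiv_chartCoord_coordFrame hp]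
  simp

theorem covariantDerivative_coordFrame_comm {D : LinearConnection E N} (hD : D.torsion = 0)
    (hp : p ∈ (chartAt E p₀).source) :
    D (coordFrame p₀ j) p (coordFrame p₀ i p) = D (coordFrame p₀ i) p (coordFrame p₀ j p) := by
  rw [← sub_eq_zero, D.torsion_eq_zero_iff.1 hD (mdifferentiableAt_coordFrame hp)
    (mdifferentiableAt_coordFrame hp), mlieBracket_coordFrame hp]

end CoordinateFrame

section FiniteSums

variable {F : Type*} [NormedAddCommGroup F] [NormedSpace ℝ F]
  {M : Type*} [TopologicalSpace M] [ChartedSpace F M]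
  {κ : Type*} {s : Finset κ} {x : M}

theorem mdifferentiableAt_finset_sum {f : κ → M → ℝ} (hf : ∀ i ∈ s, MDiffAt (f i) x) :
    MDiffAt (fun y ↦ ∑ i ∈ s, f i y) x := by
  classical
  induction s using Finset.induction_on with
  | empty => simpa using mdifferentiableAt_const
  | insert a s ha ih =>
    simp only [Finset.sum_insert ha]
    exact (hf a (Finset.mem_insert_self a s)).add
      (ih fun i hi ↦ hf i (Finset.mem_insert_of_mem hi))

theorem mvfderiv_finset_sum {f : κ → M → ℝ} (hf : ∀ i ∈ s, MDiffAt (f i) x) :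
    d% (fun y ↦ ∑ i ∈ s, f i y) x = ∑ i ∈ s, d% (f i) x := by
  classical
  induction s using Finset.induction_on with
  | empty => simp [mvfderiv_const]
  | insert a s ha ih =>
    have hs : ∀ i ∈ s, MDiffAt (f i) x := fun i hi ↦ hf i (Finset.mem_insert_of_mem hi)
    simp only [Finset.sum_insert ha]
    rw [mvfderiv_fun_add (hf a (Finset.mem_insert_self a s)) (mdifferentiableAt_finset_sum hs),
      ih hs]

theorem covariantDerivative_sum_smul [IsManifold 𝓘(ℝ, F) ∞ M] (D : LinearConnection F M)
    {a : κ → M → ℝ} {Y : κ → ∀ y : M, TangentSpace 𝓘(ℝ, F) y}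
    (ha : ∀ i ∈ s, MDiffAt (a i) x) (hY : ∀ i ∈ s, MDiffAt (T% (Y i)) x)
    (v : TangentSpace 𝓘(ℝ, F) x) :
    D (fun y ↦ ∑ i ∈ s, a i y • Y i y) x v
      = ∑ i ∈ s, (d% (a i) x v • Y i x + a i x • D (Y i) x v) := by
  classical
  induction s using Finset.induction_on with
  | empty =>
    have hzero : (fun y : M ↦ ∑ i ∈ (∅ : Finset κ), a i y • Y i y) = 0 := by ext; simp
    rw [hzero, D.zero]
    simp
  | insert c s hc ih =>
    have ha' : ∀ i ∈ s, MDiffAt (a i) x := fun i hi ↦ ha i (Finset.mem_insert_of_mem hi)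
    have hY' : ∀ i ∈ s, MDiffAt (T% (Y i)) x := fun i hi ↦ hY i (Finset.mem_insert_of_mem hi)
    have hac := ha c (Finset.mem_insert_self c s)
    have hYc := hY c (Finset.mem_insert_self c s)
    have hinsert : (fun y : M ↦ ∑ i ∈ insert c s, a i y • Y i y)
        = a c • Y c + fun y ↦ ∑ i ∈ s, a i y • Y i y := by
      ext y; simp [Finset.sum_insert hc]
    have hsum : MDiffAt (T% (fun y ↦ ∑ i ∈ s, a i y • Y i y)) x :=
      MDifferentiableAt.sum_section fun i hi ↦ (ha' i hi).smul_section (hY' i hi)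
    rw [hinsert, D.isCovariantDerivativeOnUniv.add (hac.smul_section hYc) hsum, add_apply,
      ih ha' hY', D.isCovariantDerivativeOnUniv.leibniz hYc hac, Finset.sum_insert hc]
    congr 1
    exact add_comm _ _

end FiniteSums

section CovariantDerivativeAlong

variable {E : Type*} [NormedAddCommGroup E] [NormedSpace ℝ E] [FiniteDimensional ℝ E]
  {N : Type*} [TopologicalSpace N] [ChartedSpace E N] [IsManifold 𝓘(ℝ, E) ∞ N]
  {F : Type*} [NormedAddCommGroup F] [NormedSpace ℝ F]
  {M : Type*} [TopologicalSpace M] [ChartedSpace F M]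
  {ι : M → N} {V V₁ V₂ : ∀ x : M, TangentSpace 𝓘(ℝ, E) (ι x)} {x : M}

theorem mdifferentiableAt_coordCoeff_along {p₀ : N} (hx : ι x ∈ (chartAt E p₀).source)
    (hV : MDiffAt (fun x ↦ (⟨ι x, V x⟩ : TangentBundle 𝓘(ℝ, E) N)) x)
    (i : Fin (Module.finrank ℝ E)) : MDiffAt (fun y ↦ coordCoeff p₀ i (ι y) (V y)) x := by
  have hx' : ι x ∈ (trivializationAt E (fun p : N ↦ TangentSpace 𝓘(ℝ, E) p) p₀).baseSet := by
    simpa using hx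
  have h := ((trivializationAt E (fun p : N ↦ TangentSpace 𝓘(ℝ, E) p)
    p₀).mdifferentiableAt_totalSpace_iff (IB := 𝓘(ℝ, E)) _ hx').1 hV
  have hrepr := ((Module.finBasis ℝ E).coord i).toContinuousLinearMap.mdifferentiableAt.comp x h.2
  refine hrepr.congr_of_eventuallyEq ?_
  filter_upwards [h.1.continuousAt.preimage_mem_nhds ((chartAt E p₀).open_source.mem_nhds hx)]
    with y hy using coordCoeff_apply hy (V y)

theorem covAlong_eq_sum (D : LinearConnection E N) (V : ∀ x : M, TangentSpace 𝓘(ℝ, E) (ι x))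
    (x : M) (v : TangentSpace 𝓘(ℝ, F) x) :
    covAlong D ι V x v
      = ∑ i, (d% (fun y ↦ coordCoeff (ι x) i (ι y) (V y)) x v • coordFrame (ι x) i (ι x)
        + coordCoeff (ι x) i (ι x) (V x)
          • D (coordFrame (ι x) i) (ι x) (mfderiv% ι x v)) :=
  rfl

theorem covAlong_congr (D : LinearConnection E N) (h : ∀ᶠ y in 𝓝 x, V₁ y = V₂ y)
    (v : TangentSpace 𝓘(ℝ, F) x) : covAlong D ι V₁ x v = covAlong D ι V₂ x v := by
  have hcoeff (i) : d% (fun y ↦ coordCoeff (ι x) i (ι y) (V₁ y)) x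
      = d% (fun y ↦ coordCoeff (ι x) i (ι y) (V₂ y)) x :=
    mvfderiv_congr (h.mono fun y hy ↦ congrArg (coordCoeff (ι x) i (ι y)) hy)
  simp only [covAlong_eq_sum, hcoeff, h.self_of_nhds]

theorem mvfderiv_coordCoeff_sum_smul {p₀ : N} (hx : ι x ∈ (chartAt E p₀).source) {κ : Type*}
    {s : Finset κ} {c : κ → M → ℝ} {W : κ → ∀ x : M, TangentSpace 𝓘(ℝ, E) (ι x)}
    (hc : ∀ k ∈ s, MDiffAt (c k) x)
    (hW : ∀ k ∈ s, MDiffAt (fun x ↦ (⟨ι x, W k x⟩ : TangentBundle 𝓘(ℝ, E) N)) x)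
    (v : TangentSpace 𝓘(ℝ, F) x) (i : Fin (Module.finrank ℝ E)) :
    d% (fun y ↦ coordCoeff p₀ i (ι y) (∑ k ∈ s, c k y • W k y)) x v
      = ∑ k ∈ s, (c k x * d% (fun y ↦ coordCoeff p₀ i (ι y) (W k y)) x v
        + coordCoeff p₀ i (ι x) (W k x) * d% (c k) x v) := by
  have hWi (k) (hk : k ∈ s) := mdifferentiableAt_coordCoeff_along hx (hW k hk) i
  simp only [map_sum, map_smul, smul_eq_mul]
  rw [mvfderiv_finset_sum (f := fun k y ↦ c k y * coordCoeff p₀ i (ι y) (W k y))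
    fun k hk ↦ (hc k hk).mul (hWi k hk), sum_apply]
  refine Finset.sum_congr rfl fun k hk ↦ ?_
  simp [mvfderiv_fun_mul (hc k hk) (hWi k hk)]

theorem covAlong_sum_smul (D : LinearConnection E N) {κ : Type*} {s : Finset κ}
    {c : κ → M → ℝ} {W : κ → ∀ x : M, TangentSpace 𝓘(ℝ, E) (ι x)}
    (hc : ∀ k ∈ s, MDiffAt (c k) x)
    (hW : ∀ k ∈ s, MDiffAt (fun x ↦ (⟨ι x, W k x⟩ : TangentBundle 𝓘(ℝ, E) N)) x)
    (v : TangentSpace 𝓘(ℝ, F) x) :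
    covAlong D ι (fun y ↦ ∑ k ∈ s, c k y • W k y) x v
      = ∑ k ∈ s, (d% (c k) x v • W k x + c k x • covAlong D ι (W k) x v) := by
  have hx : ι x ∈ (chartAt E (ι x)).source := mem_chart_source E (ι x)
  have hterm (k) : d% (c k) x v • W k x + c k x • covAlong D ι (W k) x v
      = ∑ i, ((c k x * d% (fun y ↦ coordCoeff (ι x) i (ι y) (W k y)) x v
          + coordCoeff (ι x) i (ι x) (W k x) * d% (c k) x v) • coordFrame (ι x) i (ι x)
        + (c k x * coordCoeff (ι x) i (ι x) (W k x))
          • D (coordFrame (ι x) i) (ι x) (mfderiv% ι x v)) := by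
    conv_lhs => rw [← sum_coordCoeff_smul hx (W k x)]
    rw [covAlong_eq_sum, Finset.smul_sum, Finset.smul_sum, ← Finset.sum_add_distrib]
    refine Finset.sum_congr rfl fun i _ ↦ ?_
    module
  simp only [hterm]
  rw [covAlong_eq_sum, Finset.sum_comm]
  refine Finset.sum_congr rfl fun i _ ↦ ?_
  rw [mvfderiv_coordCoeff_sum_smul hx hc hW, Finset.sum_smul, Finset.sum_add_distrib]
  simp only [map_sum, map_smul, smul_eq_mul, Finset.sum_smul]

theorem covAlong_comp (D : LinearConnection E N) (hι : MDiffAt ι x)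
    {Y : ∀ p : N, TangentSpace 𝓘(ℝ, E) p} (hY : MDiffAt (T% Y) (ι x))
    (v : TangentSpace 𝓘(ℝ, F) x) :
    covAlong D ι (fun y ↦ Y (ι y)) x v = D Y (ι x) (mfderiv% ι x v) := by
  have hx : ι x ∈ (chartAt E (ι x)).source := mem_chart_source E (ι x)
  have hcoeff (i) : MDiffAt (fun q ↦ coordCoeff (ι x) i q (Y q)) (ι x) :=
    mdifferentiableAt_coordCoeff_along (ι := fun q ↦ q) hx hY i
  have hchain (i) : d% (fun y ↦ coordCoeff (ι x) i (ι y) (Y (ι y))) x v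
      = d% (fun q ↦ coordCoeff (ι x) i q (Y q)) (ι x) (mfderiv% ι x v) :=
    mvfderiv_comp_apply x (hcoeff i) hι v
  have hframe (i : Fin (Module.finrank ℝ E)) : MDiffAt (T% (coordFrame (ι x) i)) (ι x) :=
    mdifferentiableAt_coordFrame hx
  rw [covAlong_eq_sum]
  simp only [hchain]
  rw [← covariantDerivative_sum_smul D
    (Y := coordFrame (ι x)) (fun i _ ↦ hcoeff i) fun i _ ↦ hframe i]
  refine DFunLike.congr_fun (D.isCovariantDerivativeOnUniv.congr_of_eventuallyEq
    (MDifferentiableAt.sum_section fun i _ ↦ (hcoeff i).smul_section (hframe i)) hY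
    Filter.univ_mem ?_) _
  filter_upwards [(chartAt E (ι x)).open_source.mem_nhds hx] with q hq
    using sum_coordCoeff_smul hq (Y q)

theorem covAlong_bronze {g : SemiRiemannianMetric E N} (J : BronzeStructure g)
    {D : LinearConnection E N} (hJ : IsParallel D J) (hι : MDiffAt ι x)
    (hV : MDiffAt (fun x ↦ (⟨ι x, V x⟩ : TangentBundle 𝓘(ℝ, E) N)) x)
    (v : TangentSpace 𝓘(ℝ, F) x) :
    covAlong D ι (fun y ↦ J.val (ι y) (V y)) x v = J.val (ι x) (covAlong D ι V x v) := by
  have hx : ι x ∈ (chartAt E (ι x)).source := mem_chart_source E (ι x)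
  have hJframe (i) : MDiffAt (T% (fun q ↦ J.val q (coordFrame (ι x) i q))) (ι x) :=
    (ContMDiffAt.clm_bundle_apply (b := fun q : N ↦ q) J.contMDiff.contMDiffAt
      (contMDiffAt_coordFrame hx)).mdifferentiableAt (by simp)
  have hexpand : ∀ᶠ y in 𝓝 x, J.val (ι y) (V y)
      = ∑ i, coordCoeff (ι x) i (ι y) (V y) • J.val (ι y) (coordFrame (ι x) i (ι y)) := by
    filter_upwards [hι.continuousAt.preimage_mem_nhds
      ((chartAt E (ι x)).open_source.mem_nhds hx)] with y hy
    conv_lhs => rw [← sum_coordCoeff_smul hy (V y)]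
    simp only [map_sum, map_smul]
  rw [covAlong_congr D hexpand, covAlong_sum_smul D
    (fun i _ ↦ mdifferentiableAt_coordCoeff_along hx hV i) (fun i _ ↦ (hJframe i).comp x hι),
    covAlong_eq_sum, map_sum]
  refine Finset.sum_congr rfl fun i _ ↦ ?_
  rw [covAlong_comp D hι (hJframe i), hJ _ _ _ (mdifferentiableAt_coordFrame hx), map_add,
    map_smul, map_smul]

theorem covAlong_addOneForm (D : LinearConnection E N)
    (A : ∀ p : N, TangentSpace 𝓘(ℝ, E) p →L[ℝ] TangentSpace 𝓘(ℝ, E) p →L[ℝ]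
      TangentSpace 𝓘(ℝ, E) p)
    (V : ∀ x : M, TangentSpace 𝓘(ℝ, E) (ι x)) (x : M) (v : TangentSpace 𝓘(ℝ, F) x) :
    covAlong (D.addOneForm A) ι V x v
      = covAlong D ι V x v + A (ι x) (V x) (mfderiv% ι x v) := by
  have hadd (i) : D.addOneForm A (coordFrame (ι x) i) (ι x) (mfderiv% ι x v)
      = D (coordFrame (ι x) i) (ι x) (mfderiv% ι x v)
        + A (ι x) (coordFrame (ι x) i (ι x)) (mfderiv% ι x v) := rfl
  conv_rhs => rw [← sum_coordCoeff_smul (mem_chart_source E (ι x)) (V x)]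
  simp only [covAlong_eq_sum, hadd, map_sum, map_smul, sum_apply,
    smul_apply, smul_add, Finset.sum_add_distrib, add_assoc]

theorem covAlong_lmConnection {g : SemiRiemannianMetric E N} (J : BronzeStructure g)
    (D : LinearConnection E N) (η : ∀ p : N, TangentSpace 𝓘(ℝ, E) p) (l m : N → ℝ)
    (V : ∀ x : M, TangentSpace 𝓘(ℝ, E) (ι x)) (x : M) (v : TangentSpace 𝓘(ℝ, F) x) :
    covAlong (lmConnection g J D η l m) ι V x v
      = covAlong D ι V x v + g.val (ι x) (η (ι x)) (V x)
        • (l (ι x) • mfderiv% ι x v + m (ι x) • J.val (ι x) (mfderiv% ι x v)) :=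
  covAlong_addOneForm D _ V x v

theorem coordCoeff_push {p₀ : N} (hx : ι x ∈ (chartAt E p₀).source) (hι : MDiffAt ι x)
    (X : ∀ x : M, TangentSpace 𝓘(ℝ, F) x) (i : Fin (Module.finrank ℝ E)) :
    coordCoeff p₀ i (ι x) (push E ι X x) = d% (chartCoord p₀ i ∘ ι) x (X x) := by
  rw [coordCoeff_eq_mvfderiv_chartCoord hx,
    mvfderiv_comp_apply x ((contMDiffAt_chartCoord hx).mdifferentiableAt (by simp)) hι]
  rfl

theorem mvfderiv_coordCoeff_push_sub [CompleteSpace F] [IsManifold 𝓘(ℝ, F) 2 M] {p₀ : N}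
    (hx : ι x ∈ (chartAt E p₀).source) (hι : CMDiffAt 2 ι x)
    {X Y : ∀ x : M, TangentSpace 𝓘(ℝ, F) x} (hX : MDiffAt (T% X) x) (hY : MDiffAt (T% Y) x)
    (i : Fin (Module.finrank ℝ E)) :
    d% (fun y ↦ coordCoeff p₀ i (ι y) (push E ι Y y)) x (X x)
        - d% (fun y ↦ coordCoeff p₀ i (ι y) (push E ι X y)) x (Y x)
      = coordCoeff p₀ i (ι x) (push E ι (VectorField.mlieBracket 𝓘(ℝ, F) X Y) x) := by
  have hcoeff (Z : ∀ x : M, TangentSpace 𝓘(ℝ, F) x) :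
      d% (fun y ↦ coordCoeff p₀ i (ι y) (push E ι Z y)) x
        = d% (fun y ↦ d% (chartCoord p₀ i ∘ ι) y (Z y)) x := by
    refine mvfderiv_congr ?_
    filter_upwards [hι.continuousAt.preimage_mem_nhds
      ((chartAt E p₀).open_source.mem_nhds hx),
      (contMDiffAt_iff_contMDiffAt_nhds (by simp)).1 hι] with y hy hιy
      using coordCoeff_push hy (hιy.mdifferentiableAt two_ne_zero) Z i
  rw [hcoeff, hcoeff, coordCoeff_push hx (hι.mdifferentiableAt two_ne_zero)]
  exact mvfderiv_mvfderiv_sub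
    (((contMDiffAt_chartCoord hx).of_le ENat.LEInfty.out).comp x hι) hX hY

theorem sum_coordCoeff_smul_covariantDerivative_comm {D : LinearConnection E N}
    (hD : D.torsion = 0) {p₀ p : N} (hp : p ∈ (chartAt E p₀).source)
    (u w : TangentSpace 𝓘(ℝ, E) p) :
    ∑ i, coordCoeff p₀ i p u • D (coordFrame p₀ i) p w
      = ∑ i, coordCoeff p₀ i p w • D (coordFrame p₀ i) p u := by
  have hexpand (i) (z : TangentSpace 𝓘(ℝ, E) p) : D (coordFrame p₀ i) p z
      = ∑ j, coordCoeff p₀ j p z • D (coordFrame p₀ i) p (coordFrame p₀ j p) := by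
    conv_lhs => rw [← sum_coordCoeff_smul hp z]
    simp only [map_sum, map_smul]
  simp only [hexpand _ w, hexpand _ u, Finset.smul_sum]
  rw [Finset.sum_comm]
  refine Finset.sum_congr rfl fun i _ ↦ Finset.sum_congr rfl fun j _ ↦ ?_
  rw [smul_comm, covariantDerivative_coordFrame_comm hD hp]

theorem covAlong_push_sub [CompleteSpace F] [IsManifold 𝓘(ℝ, F) 2 M] {D : LinearConnection E N}
    (hD : D.torsion = 0) (hι : CMDiffAt 2 ι x) {X Y : ∀ x : M, TangentSpace 𝓘(ℝ, F) x}
    (hX : MDiffAt (T% X) x) (hY : MDiffAt (T% Y) x) :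
    covAlong D ι (push E ι Y) x (X x) - covAlong D ι (push E ι X) x (Y x)
      = push E ι (VectorField.mlieBracket 𝓘(ℝ, F) X Y) x := by
  have hx : ι x ∈ (chartAt E (ι x)).source := mem_chart_source E (ι x)
  have hsymm := sum_coordCoeff_smul_covariantDerivative_comm hD hx (push E ι Y x) (push E ι X x)
  rw [← sum_coordCoeff_smul hx (push E ι (VectorField.mlieBracket 𝓘(ℝ, F) X Y) x)]
  simp only [covAlong_eq_sum, ← mvfderiv_coordCoeff_push_sub hx hι hX hY, sub_smul,
    Finset.sum_add_distrib, Finset.sum_sub_distrib]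
  exact (congrArg₂ (· - ·) (congrArg₂ (· + ·) rfl hsymm) rfl).trans
    (add_sub_add_right_eq_sub _ _ _)

end CovariantDerivativeAlong

section Sections
variable {E : Type*} [NormedAddCommGroup E] [NormedSpace ℝ E]
  {N : Type*} [TopologicalSpace N] [ChartedSpace E N] [IsManifold 𝓘(ℝ, E) ∞ N]
  {F : Type*} [NormedAddCommGroup F] [NormedSpace ℝ F]
  {M : Type*} [TopologicalSpace M] [ChartedSpace F M] {ι : M → N}

theorem contMDiff_push [IsManifold 𝓘(ℝ, F) ∞ M] (hι : CMDiff ∞ ι)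
    {X : ∀ x : M, TangentSpace 𝓘(ℝ, F) x} (hX : CMDiff ∞ (T% X)) :
    CMDiff ∞ (fun x ↦ (⟨ι x, push E ι X x⟩ : TangentBundle 𝓘(ℝ, E) N)) :=
  (hι.contMDiff_tangentMap (m := ∞) (by simp)).comp hX

theorem contMDiffAt_sum_smul_along {κ : Type*} [Fintype κ] {y : M} (hι : CMDiffAt ∞ ι y)
    {f : κ → M → ℝ} (hf : ∀ i, CMDiffAt ∞ (f i) y)
    {s : κ → ∀ x : M, TangentSpace 𝓘(ℝ, E) (ι x)}
    (hs : ∀ i, CMDiffAt ∞ (fun x ↦ (⟨ι x, s i x⟩ : TangentBundle 𝓘(ℝ, E) N)) y) :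
    CMDiffAt ∞ (fun x ↦ (⟨ι x, ∑ i, f i x • s i x⟩ : TangentBundle 𝓘(ℝ, E) N)) y := by
  let e := trivializationAt E (fun p : N ↦ TangentSpace 𝓘(ℝ, E) p) (ι y)
  have hy : ι y ∈ e.baseSet := mem_baseSet_trivializationAt E _ (ι y)
  have hsource (v : TangentSpace 𝓘(ℝ, E) (ι y)) :
      (⟨ι y, v⟩ : TangentBundle 𝓘(ℝ, E) N) ∈ e.source := e.mem_source.2 hy
  have hs' (i : κ) :
      CMDiffAt ∞ (fun x ↦ (e (⟨ι x, s i x⟩ : TangentBundle 𝓘(ℝ, E) N)).2) y :=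
    ((e.contMDiffAt_iff (f := fun x ↦ (⟨ι x, s i x⟩ : TangentBundle 𝓘(ℝ, E) N))
      (hsource _)).1 (hs i)).2
  refine (e.contMDiffAt_iff
    (f := fun x ↦ (⟨ι x, ∑ i, f i x • s i x⟩ : TangentBundle 𝓘(ℝ, E) N)) (hsource _)).2
    ⟨hι, (contMDiffAt_finsetSum (t := Finset.univ) fun i _ ↦
      (hf i).smul (hs' i)).congr_of_eventuallyEq ?_⟩
  filter_upwards [hι.continuousAt.preimage_mem_nhds (e.open_baseSet.mem_nhds hy)] with z hz
  have hlin (v : TangentSpace 𝓘(ℝ, E) (ι z)) :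
      (e (⟨ι z, v⟩ : TangentBundle 𝓘(ℝ, E) N)).2 = e.linearMapAt ℝ (ι z) v := by
    rw [Trivialization.linearMapAt_apply, if_pos (mem_preimage.1 hz)]
  simp only [hlin, map_smul, map_sum, Pi.smul_apply']

theorem contMDiff_sum_smul_of_tsupport_subset {κ : Type*} [Fintype κ] (hι : CMDiff ∞ ι)
    {U : Set M} (hU : IsOpen U) {f : κ → M → ℝ} (hf : ∀ i, CMDiff ∞ (f i))
    (hfU : ∀ i, tsupport (f i) ⊆ U) {s : κ → ∀ x : M, TangentSpace 𝓘(ℝ, E) (ι x)}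
    (hs : ∀ i, IsSmoothAlongOn F ι (s i) U) :
    CMDiff ∞ (fun x ↦ (⟨ι x, ∑ i, f i x • s i x⟩ : TangentBundle 𝓘(ℝ, E) N)) := by
  intro y
  by_cases hy : y ∈ U
  · exact contMDiffAt_sum_smul_along hι.contMDiffAt (fun i ↦ (hf i).contMDiffAt)
      fun i ↦ (hs i).contMDiffAt (hU.mem_nhds hy)
  · have hzero : CMDiff ∞ (fun x ↦ (⟨ι x, 0⟩ : TangentBundle 𝓘(ℝ, E) N)) :=
      (contMDiff_zeroSection ℝ (fun p : N ↦ TangentSpace 𝓘(ℝ, E) p)).comp hι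
    refine hzero.contMDiffAt.congr_of_eventuallyEq ?_
    have hf0 (i : κ) : f i =ᶠ[𝓝 y] 0 :=
      notMem_tsupport_iff_eventuallyEq.1 fun h ↦ hy (hfU i h)
    filter_upwards [Filter.eventually_all.2 hf0] with z hz
    simp only [hz, Pi.zero_apply, zero_smul, Finset.sum_const_zero]

theorem exists_isSection_apply_eq [FiniteDimensional ℝ F] [T2Space M] [IsManifold 𝓘(ℝ, F) ∞ M]
    (hι : CMDiff ∞ ι) {k : ℕ} {D : ∀ x : M, Submodule ℝ (TangentSpace 𝓘(ℝ, E) (ι x))}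
    (hD : IsSubbundleAlong F ι k D) {x₀ : M} {u : TangentSpace 𝓘(ℝ, E) (ι x₀)} (hu : u ∈ D x₀) :
    ∃ V, IsSection F ι D V ∧ V x₀ = u := by
  obtain ⟨U, hU, hx₀, s, hs, hsD⟩ := hD x₀
  rw [← (hsD x₀ hx₀).2, Submodule.mem_span_range_iff_exists_fun] at hu
  obtain ⟨c, rfl⟩ := hu
  obtain ⟨f, -, hfU⟩ := (SmoothBumpFunction.nhds_basis_tsupport (I := 𝓘(ℝ, F)) x₀).mem_iff.1
    (hU.mem_nhds hx₀)
  refine ⟨fun x ↦ ∑ i, (f x • c i) • s i x, ⟨?_, fun x ↦ ?_⟩, ?_⟩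
  · exact (contMDiff_sum_smul_of_tsupport_subset hι hU
      (fun i ↦ f.contMDiff.smul contMDiff_const)
      (fun i ↦ (tsupport_smul_subset_left f _).trans hfU) hs).contMDiffOn
  · by_cases hx : x ∈ U
    · rw [← (hsD x hx).2]
      exact Submodule.sum_smul_mem _ _ fun i _ ↦ Submodule.subset_span (mem_range_self i)
    · have hfx : f x = 0 := image_eq_zero_of_notMem_tsupport fun h ↦ hx (hfU h)
      simp only [hfx, zero_smul, Finset.sum_const_zero, Submodule.zero_mem]
  · simp only [f.eq_one, one_smul]

end Sections

section Pointwise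
variable {E : Type*} [NormedAddCommGroup E] [NormedSpace ℝ E]
  {N : Type*} [TopologicalSpace N] [ChartedSpace E N] [IsManifold 𝓘(ℝ, E) ∞ N]
  {F : Type*} [NormedAddCommGroup F] [NormedSpace ℝ F]
  {M : Type*} [TopologicalSpace M] [ChartedSpace F M]
  {g : SemiRiemannianMetric E N} {J : BronzeStructure g} {ι : M → N} {x : M}

theorem sup_orth_eq_top [FiniteDimensional ℝ E] {p : N}
    {D : Submodule ℝ (TangentSpace 𝓘(ℝ, E) p)} (hD : D ⊓ orth g D = ⊥) : D ⊔ orth g D = ⊤ := by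
  have : FiniteDimensional ℝ (TangentSpace 𝓘(ℝ, E) p) := ‹FiniteDimensional ℝ E›
  let B : LinearMap.BilinForm ℝ (TangentSpace 𝓘(ℝ, E) p) :=
    (ContinuousLinearMap.coeLM ℝ).comp (g.val p).toLinearMap
  have hB : B.IsRefl := fun u v huv ↦ (g.symm p v u).trans huv
  exact ((LinearMap.BilinForm.isCompl_orthogonal_iff_disjoint hB).2
    (disjoint_iff.2 hD)).sup_eq_top

theorem bronze_bronze_sub (J : BronzeStructure g) (p : N) (v : TangentSpace 𝓘(ℝ, E) p) :
    J.val p (J.val p v - (3 : ℝ) • v) = v := by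
  rw [map_sub, map_smul, J.sq, add_sub_cancel_left]

theorem bronze_injective (J : BronzeStructure g) (p : N) : Function.Injective (J.val p) := by
  refine (injective_iff_map_eq_zero (J.val p)).2 fun v hv ↦ ?_
  rw [← bronze_bronze_sub J p v, map_sub, map_smul, hv, map_zero, smul_zero, sub_zero]

namespace LightlikeSubmanifold

variable (S : LightlikeSubmanifold F g ι) {v w z : TangentSpace 𝓘(ℝ, E) (ι x)}

theorem screen_le_tangent : S.screen x ≤ tangent E F ι x :=
  le_sup_right.trans (S.screen_sup x).le

theorem screenTrans_le_orth_tangent : S.screenTrans x ≤ orth g (tangent E F ι x) :=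
  le_sup_right.trans (S.screenTrans_sup x).le

theorem ltr_le_orth_screen_sup_screenTrans :
    S.ltr x ≤ orth g (S.screen x ⊔ S.screenTrans x) :=
  le_sup_right.trans (S.ltr_sup x).le

theorem tangentPart_mem (w : TangentSpace 𝓘(ℝ, E) (ι x)) :
    S.tangentPart x w ∈ tangent E F ι x :=
  Submodule.projection_apply_mem _ w

theorem radicalPart_mem (w : TangentSpace 𝓘(ℝ, E) (ι x)) :
    S.radicalPart x w ∈ radical F g ι x :=
  Submodule.projection_apply_mem _ w

theorem screenPart_mem (w : TangentSpace 𝓘(ℝ, E) (ι x)) : S.screenPart x w ∈ S.screen x :=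
  Submodule.projection_apply_mem _ w

theorem screenTransPart_mem (w : TangentSpace 𝓘(ℝ, E) (ι x)) :
    S.screenTransPart x w ∈ S.screenTrans x :=
  Submodule.projection_apply_mem _ w

theorem tangentPart_of_mem (hv : v ∈ tangent E F ι x) : S.tangentPart x v = v :=
  Submodule.projection_apply_of_mem_left _ hv

theorem radicalPart_of_mem (hv : v ∈ radical F g ι x) : S.radicalPart x v = v :=
  Submodule.projection_apply_of_mem_left _ hv

theorem radicalPart_of_mem_screen (hv : v ∈ S.screen x) : S.radicalPart x v = 0 :=
  (Submodule.projection_apply_eq_zero_iff _).2 (Submodule.mem_sup_left hv)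

theorem radicalPart_add_screenPart (hv : v ∈ tangent E F ι x) :
    S.radicalPart x v + S.screenPart x v = v := by
  rw [← S.screen_sup x] at hv
  obtain ⟨a, ha, s, hs, rfl⟩ := Submodule.mem_sup.1 hv
  have hsa : S.screenPart x a = 0 :=
    (Submodule.projection_apply_eq_zero_iff _).2 (Submodule.mem_sup_left ha)
  have hss : S.screenPart x s = s := Submodule.projection_apply_of_mem_left _ hs
  rw [map_add, map_add, S.radicalPart_of_mem ha, S.radicalPart_of_mem_screen hs, hsa, hss,
    add_zero, zero_add]

theorem exists_eq_add_add_add (v : TangentSpace 𝓘(ℝ, E) (ι x)) :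
    ∃ a ∈ radical F g ι x, ∃ s ∈ S.screen x, ∃ l ∈ S.ltr x, ∃ t ∈ S.screenTrans x,
      v = a + s + l + t := by
  have h : v ∈ tangent E F ι x ⊔ (S.ltr x ⊔ S.screenTrans x) := by
    rw [(S.isCompl_tangent x).sup_eq_top]; trivial
  rw [← S.screen_sup x] at h
  obtain ⟨_, h1, _, h2, rfl⟩ := Submodule.mem_sup.1 h
  obtain ⟨a, ha, s, hs, rfl⟩ := Submodule.mem_sup.1 h1
  obtain ⟨l, hl, t, ht, rfl⟩ := Submodule.mem_sup.1 h2
  exact ⟨a, ha, s, hs, l, hl, t, ht, (add_assoc _ _ _).symm⟩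

theorem eq_zero_of_mem_radical (hv : v ∈ radical F g ι x)
    (h : ∀ u ∈ S.ltr x, g.val (ι x) v u = 0) : v = 0 := by
  refine g.nondegenerate (ι x) v fun w ↦ ?_
  obtain ⟨b, hb, s, hs, l, hl, t, ht, rfl⟩ := S.exists_eq_add_add_add w
  rw [map_add, map_add, map_add, h l hl, S.screenTrans_le_orth_tangent ht v hv.1,
    hb.2 v hv.1, g.symm, hv.2 s (S.screen_le_tangent hs)]
  simp only [add_zero]

theorem eq_zero_of_mem_ltr (hv : v ∈ S.ltr x)
    (h : ∀ u ∈ radical F g ι x, g.val (ι x) v u = 0) : v = 0 := by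
  refine g.nondegenerate (ι x) v fun w ↦ ?_
  obtain ⟨b, hb, s, hs, l, hl, t, ht, rfl⟩ := S.exists_eq_add_add_add w
  have hv' := S.ltr_le_orth_screen_sup_screenTrans hv
  rw [map_add, map_add, map_add, h b hb, S.ltr_null x v hv l hl, g.symm,
    hv' s (Submodule.mem_sup_left hs), g.symm, hv' t (Submodule.mem_sup_right ht)]
  simp only [add_zero]

theorem eq_zero_of_mem_screen (hv : v ∈ S.screen x)
    (h : ∀ u ∈ S.screen x, g.val (ι x) v u = 0) : v = 0 := by
  have hvt := S.screen_le_tangent hv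
  have hrad : v ∈ radical F g ι x ⊓ S.screen x := by
    refine ⟨⟨hvt, fun w hw ↦ ?_⟩, hv⟩
    rw [← S.screen_sup x] at hw
    obtain ⟨b, hb, s, hs, rfl⟩ := Submodule.mem_sup.1 hw
    rw [g.symm, map_add, hb.2 v hvt, h s hs, add_zero]
  rwa [S.screen_inf x, Submodule.mem_bot] at hrad

theorem tangentPart_add_screenTransPart (hw : w ∈ orth g (radical F g ι x)) :
    S.tangentPart x w + S.screenTransPart x w = w := by
  obtain ⟨a, ha, s, hs, l, hl, t, ht, rfl⟩ := S.exists_eq_add_add_add w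
  have hp : a + s ∈ tangent E F ι x := add_mem ha.1 (S.screen_le_tangent hs)
  obtain rfl : l = 0 := S.eq_zero_of_mem_ltr hl fun u hu ↦ by
    have h := hw u hu
    rwa [map_add, map_add, S.screenTrans_le_orth_tangent ht u hu.1, g.symm, hu.2 _ hp, zero_add,
      add_zero, g.symm] at h
  have htp : S.tangentPart x t = 0 :=
    (Submodule.projection_apply_eq_zero_iff _).2 (Submodule.mem_sup_right ht)
  have hpt : S.screenTransPart x (a + s) = 0 :=
    (Submodule.projection_apply_eq_zero_iff _).2 (Submodule.mem_sup_left hp)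
  have htt : S.screenTransPart x t = t := Submodule.projection_apply_of_mem_left _ ht
  rw [add_zero, map_add _ (a + s), map_add _ (a + s), S.tangentPart_of_mem hp, htp, hpt, htt,
    add_zero, zero_add]

theorem apply_f_of_mem_screen (hv : v ∈ S.screen x) (z : TangentSpace 𝓘(ℝ, E) (ι x)) :
    g.val (ι x) v (S.f x J z) = g.val (ι x) v (J.val (ι x) z) := by
  have h : J.val (ι x) z - S.f x J z ∈ S.ltr x ⊔ S.screenTrans x :=
    Submodule.sub_projection_mem (S.isCompl_tangent x) _
  obtain ⟨l, hl, t, ht, hlt⟩ := Submodule.mem_sup.1 h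
  have hg := congrArg (g.val (ι x) v) hlt
  rw [map_add, map_sub, S.ltr_le_orth_screen_sup_screenTrans hl v (Submodule.mem_sup_left hv),
    S.screenTrans_le_orth_tangent ht v (S.screen_le_tangent hv), add_zero] at hg
  exact (sub_eq_zero.1 hg.symm).symm

theorem B₀_le_screen : S.B₀ J x ≤ S.screen x :=
  inf_le_right

theorem bronze_mem_B₀ (hv : v ∈ S.B₀ J x) : J.val (ι x) v ∈ S.B₀ J x := by
  obtain ⟨⟨w, hw, rfl⟩, hv'⟩ := hv
  refine ⟨⟨_, hv', rfl⟩, ?_⟩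
  change J.val (ι x) (J.val (ι x) w) ∈ S.screen x
  rw [J.sq]
  exact add_mem (Submodule.smul_mem _ _ hv') hw

end LightlikeSubmanifold

namespace ScreenGenericLightlikeSubmanifold

theorem bronze_mem_radical (S : ScreenGenericLightlikeSubmanifold F g J ι)
    {v : TangentSpace 𝓘(ℝ, E) (ι x)} (hv : v ∈ radical F g ι x) :
    J.val (ι x) v ∈ radical F g ι x := by
  rw [← S.radical_invariant x]
  exact ⟨v, hv, rfl⟩

variable (S : ScreenGenericLightlikeSubmanifold F g J ι) {v w z β : TangentSpace 𝓘(ℝ, E) (ι x)}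

theorem mem_Bprime_iff :
    z ∈ S.Bprime x ↔ z ∈ S.screen x ∧ z ∈ orth g (S.B₀ J x) := by
  rw [S.Bprime_eq x, Submodule.mem_inf]

theorem B₀_sup_Bprime [FiniteDimensional ℝ E] : S.B₀ J x ⊔ S.Bprime x = S.screen x := by
  rw [S.Bprime_eq x, inf_comm,
    ← sup_inf_assoc_of_le _ S.B₀_le_screen,
    sup_orth_eq_top (S.B₀_nondegenerate x), top_inf_eq]

theorem mem_B₀_iff_of_mem_screen [FiniteDimensional ℝ E] (hv : v ∈ S.screen x) :
    v ∈ S.B₀ J x ↔ v ∈ orth g (S.Bprime x) := by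
  refine ⟨fun hvB z hz ↦ (g.symm _ z v).trans ((S.mem_Bprime_iff.1 hz).2 v hvB), fun h ↦ ?_⟩
  rw [← S.B₀_sup_Bprime] at hv
  obtain ⟨b, hb, z, hz, rfl⟩ := Submodule.mem_sup.1 hv
  have hz' := S.mem_Bprime_iff.1 hz
  obtain rfl : z = 0 := S.eq_zero_of_mem_screen hz'.1 fun y hy ↦ by
    rw [← S.B₀_sup_Bprime] at hy
    obtain ⟨c, hc, q, hq, rfl⟩ := Submodule.mem_sup.1 hy
    have hqz := h q hq
    rw [map_add, g.symm _ q b, (S.mem_Bprime_iff.1 hq).2 b hb, zero_add] at hqz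
    rw [map_add, g.symm, hz'.2 c hc, g.symm, hqz, add_zero]
  rwa [add_zero]

theorem radicalPart_tangentPart_bronze_add [FiniteDimensional ℝ E] (hv : v ∈ tangent E F ι x)
    (hvB : v ∈ orth g (S.Bprime x)) (hβ : β ∈ S.B₀ J x) :
    S.radicalPart x (S.tangentPart x (J.val (ι x) v + β))
      = J.val (ι x) (S.radicalPart x v) := by
  obtain ⟨a, ha, s, hs, rfl⟩ : ∃ a ∈ radical F g ι x, ∃ s ∈ S.screen x, a + s = v :=
    Submodule.mem_sup.1 ((S.screen_sup x).symm ▸ hv)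
  have hsB : s ∈ S.B₀ J x := (S.mem_B₀_iff_of_mem_screen hs).2 fun z hz ↦ by
    have hz' := hvB z hz
    rwa [map_add, ha.2 z (S.screen_le_tangent (S.mem_Bprime_iff.1 hz).1), zero_add] at hz'
  have hJa := S.bronze_mem_radical ha
  have hJs := S.B₀_le_screen (add_mem (S.bronze_mem_B₀ hsB) hβ)
  rw [map_add (J.val (ι x)), add_assoc,
    S.tangentPart_of_mem (add_mem hJa.1 (S.screen_le_tangent hJs)), map_add _ (J.val (ι x) a),
    map_add _ a s, S.radicalPart_of_mem ha, S.radicalPart_of_mem_screen hs,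
    S.radicalPart_of_mem hJa, S.radicalPart_of_mem_screen hJs, add_zero, add_zero]

theorem mem_B₀_iff_radicalPart_eq_zero [FiniteDimensional ℝ E] (hv : v ∈ tangent E F ι x)
    (hβ : β ∈ S.B₀ J x) :
    v ∈ S.B₀ J x ↔ S.radicalPart x (S.tangentPart x (J.val (ι x) v + β)) = 0 ∧
      v ∈ orth g (S.Bprime x) := by
  refine ⟨fun h ↦ ?_, fun ⟨hrad, hvB⟩ ↦ ?_⟩
  · have hvs := S.B₀_le_screen h
    have hvB := (S.mem_B₀_iff_of_mem_screen hvs).1 h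
    refine ⟨?_, hvB⟩
    rw [S.radicalPart_tangentPart_bronze_add hv hvB hβ, S.radicalPart_of_mem_screen hvs, map_zero]
  · rw [S.radicalPart_tangentPart_bronze_add hv hvB hβ] at hrad
    have hrad0 : S.radicalPart x v = 0 :=
      bronze_injective J (ι x) (hrad.trans (map_zero _).symm)
    have hvs := S.radicalPart_add_screenPart hv
    rw [hrad0, zero_add] at hvs
    exact (S.mem_B₀_iff_of_mem_screen (hvs ▸ S.screenPart_mem v)).2 hvB

theorem eq_zero_iff_forall_ltr (hv : v ∈ radical F g ι x) :
    v = 0 ↔ ∀ u ∈ S.ltr x, g.val (ι x) v (J.val (ι x) u) = 3 * g.val (ι x) v u := by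
  refine ⟨fun h u _ ↦ by simp only [h, map_zero, zero_apply, mul_zero], fun h ↦ ?_⟩
  have hJv : J.val (ι x) v - (3 : ℝ) • v = 0 := by
    refine S.eq_zero_of_mem_radical
      (sub_mem (S.bronze_mem_radical hv) (Submodule.smul_mem _ _ hv)) fun u hu ↦ ?_
    simp only [map_sub, map_smul, sub_apply, smul_apply, smul_eq_mul]
    rw [← J.compatible, h u hu, sub_self]
  rw [← bronze_bronze_sub J (ι x) v, hJv, map_zero]

theorem apply_bronze_sub_of_mem_tangent (hw : w ∈ orth g (radical F g ι x))
    (hz : z ∈ tangent E F ι x) :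
    g.val (ι x) w (J.val (ι x) z - (3 : ℝ) • z)
      = g.val (ι x) (S.screenPart x (S.tangentPart x w)) (S.f x J z)
        + g.val (ι x) (S.screenTransPart x w) (J.val (ι x) z)
        - 3 * g.val (ι x) (S.screenPart x (S.tangentPart x w)) z := by
  have hdecomp := S.tangentPart_add_screenTransPart hw
  have ha := S.radicalPart_mem (S.tangentPart x w)
  have ht := S.screenTransPart_mem w
  rw [← S.radicalPart_add_screenPart (S.tangentPart_mem w)] at hdecomp
  rw [S.apply_f_of_mem_screen (S.screenPart_mem _)]
  nth_rewrite 1 [← hdecomp]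
  simp only [map_add, map_sub, map_smul, add_apply, smul_eq_mul]
  rw [J.compatible _ (S.radicalPart x _), g.symm _ (J.val (ι x) _) z,
    (S.bronze_mem_radical ha).2 z hz, g.symm _ (S.radicalPart x _) z, ha.2 z hz,
    g.symm _ (S.screenTransPart x w) z, S.screenTrans_le_orth_tangent ht z hz]
  ring

theorem apply_bronze_add_bronze_sub (v : TangentSpace 𝓘(ℝ, E) (ι x)) (hβ : β ∈ S.B₀ J x)
    (hz : z ∈ S.Bprime x) :
    g.val (ι x) (J.val (ι x) v + β) (J.val (ι x) z - (3 : ℝ) • z) = g.val (ι x) v z := by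
  have hz' := (S.mem_Bprime_iff.1 hz).2
  have hβz : g.val (ι x) β (J.val (ι x) z - (3 : ℝ) • z) = 0 := by
    rw [map_sub, map_smul, J.compatible, hz' _ (S.bronze_mem_B₀ hβ), hz' β hβ,
      smul_zero, sub_zero]
  rw [map_add, add_apply, hβz, add_zero, ← J.compatible, bronze_bronze_sub]

theorem bronze_add_mem_orth_radical (hv : v ∈ tangent E F ι x) (hβ : β ∈ S.B₀ J x) :
    J.val (ι x) v + β ∈ orth g (radical F g ι x) := fun u hu ↦ by
  rw [map_add, J.compatible, g.symm, (S.bronze_mem_radical hu).2 v hv, g.symm,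
    hu.2 β (S.screen_le_tangent (S.B₀_le_screen hβ)), add_zero]

theorem mem_B₀_iff [FiniteDimensional ℝ E] (hv : v ∈ tangent E F ι x) (hβ : β ∈ S.B₀ J x)
    (hw : w = J.val (ι x) v + β) :
    v ∈ S.B₀ J x ↔
      (∀ u ∈ S.ltr x, g.val (ι x) (S.radicalPart x (S.tangentPart x w)) (J.val (ι x) u)
        = 3 * g.val (ι x) (S.radicalPart x (S.tangentPart x w)) u) ∧
      (∀ z ∈ S.Bprime x, g.val (ι x) (S.screenPart x (S.tangentPart x w)) (S.f x J z)
          + g.val (ι x) (S.screenTransPart x w) (J.val (ι x) z)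
        = 3 * g.val (ι x) (S.screenPart x (S.tangentPart x w)) z) := by
  subst hw
  rw [S.mem_B₀_iff_radicalPart_eq_zero hv hβ, S.eq_zero_iff_forall_ltr (S.radicalPart_mem _)]
  refine and_congr_right fun _ ↦ forall₂_congr fun z hz ↦ ?_
  rw [g.symm, ← S.apply_bronze_add_bronze_sub v hβ hz, S.apply_bronze_sub_of_mem_tangent
    (S.bronze_add_mem_orth_radical hv hβ) (S.screen_le_tangent (S.mem_Bprime_iff.1 hz).1),
    sub_eq_zero]

end ScreenGenericLightlikeSubmanifold

end Pointwise

section Bracket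
variable {E : Type*} [NormedAddCommGroup E] [NormedSpace ℝ E] [FiniteDimensional ℝ E]
  {N : Type*} [TopologicalSpace N] [ChartedSpace E N] [IsManifold 𝓘(ℝ, E) ∞ N]
  {F : Type*} [NormedAddCommGroup F] [NormedSpace ℝ F] [CompleteSpace F]
  {M : Type*} [TopologicalSpace M] [ChartedSpace F M] [IsManifold 𝓘(ℝ, F) ∞ M]
  {g : SemiRiemannianMetric E N} {J : BronzeStructure g} {D : LinearConnection E N}
  {ι : M → N} {X Y : ∀ x : M, TangentSpace 𝓘(ℝ, F) x}

theorem covAlong_lmConnection_pushJ_sub (hD : D.torsion = 0) (hJ : IsParallel D J)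
    (η : ∀ p : N, TangentSpace 𝓘(ℝ, E) p) (l m : N → ℝ) (hι : CMDiff ∞ ι)
    (hX : CMDiff ∞ (T% X)) (hY : CMDiff ∞ (T% Y)) (x : M) :
    covAlong (lmConnection g J D η l m) ι (pushJ J ι Y) x (X x)
        - covAlong (lmConnection g J D η l m) ι (pushJ J ι X) x (Y x)
      = J.val (ι x) (push E ι (VectorField.mlieBracket 𝓘(ℝ, F) X Y) x)
        + (g.val (ι x) (η (ι x)) (pushJ J ι Y x)
            • (l (ι x) • push E ι X x + m (ι x) • pushJ J ι X x)
          - g.val (ι x) (η (ι x)) (pushJ J ι X x)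
            • (l (ι x) • push E ι Y x + m (ι x) • pushJ J ι Y x)) := by
  have hιx : MDiffAt ι x := hι.mdifferentiableAt (by simp)
  have hJY := covAlong_bronze J hJ hιx
    ((contMDiff_push hι hY).mdifferentiableAt (by simp)) (X x)
  have hJX := covAlong_bronze J hJ hιx
    ((contMDiff_push hι hX).mdifferentiableAt (by simp)) (Y x)
  rw [← covAlong_push_sub hD (hι.contMDiffAt.of_le ENat.LEInfty.out)
    (hX.mdifferentiableAt (by simp)) (hY.mdifferentiableAt (by simp)),
    covAlong_lmConnection, covAlong_lmConnection, map_sub, ← hJY, ← hJX]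
  exact add_sub_add_comm _ _ _ _

namespace ScreenGenericLightlikeSubmanifold

theorem exists_covAlong_lmConnection_pushJ_sub_eq
    (S : ScreenGenericLightlikeSubmanifold F g J ι) (hD : D.torsion = 0) (hJ : IsParallel D J)
    (η : ∀ p : N, TangentSpace 𝓘(ℝ, E) p) (l m : N → ℝ)
    (hX : IsTangentSection ι (S.B₀ J) X) (hY : IsTangentSection ι (S.B₀ J) Y) (x : M) :
    ∃ β ∈ S.B₀ J x,
      covAlong (lmConnection g J D η l m) ι (pushJ J ι Y) x (X x)
          - covAlong (lmConnection g J D η l m) ι (pushJ J ι X) x (Y x)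
        = J.val (ι x) (push E ι (VectorField.mlieBracket 𝓘(ℝ, F) X Y) x) + β := by
  have hmem {Z : ∀ x : M, TangentSpace 𝓘(ℝ, F) x} (hZ : IsTangentSection ι (S.B₀ J) Z) (c : ℝ) :
      c • (l (ι x) • push E ι Z x + m (ι x) • pushJ J ι Z x) ∈ S.B₀ J x :=
    Submodule.smul_mem _ c (add_mem (Submodule.smul_mem _ _ (hZ.2 x))
      (Submodule.smul_mem _ _ (S.bronze_mem_B₀ (hZ.2 x))))
  exact ⟨_, sub_mem (hmem hX _) (hmem hY _),
    covAlong_lmConnection_pushJ_sub hD hJ η l m S.isImmersion.contMDiff hX.1 hY.1 x⟩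

theorem push_mlieBracket_mem_B₀_iff
    (S : ScreenGenericLightlikeSubmanifold F g J ι) (hD : D.torsion = 0) (hJ : IsParallel D J)
    (η : ∀ p : N, TangentSpace 𝓘(ℝ, E) p) (l m : N → ℝ)
    (hX : IsTangentSection ι (S.B₀ J) X) (hY : IsTangentSection ι (S.B₀ J) Y) (x : M) :
    let Ω := lmConnection g J D η l m
    let Jp := pushJ (F := F) J ι
    push E ι (VectorField.mlieBracket 𝓘(ℝ, F) X Y) x ∈ S.B₀ J x ↔
      (∀ u ∈ S.ltr x,
        g.val (ι x) (S.radicalForm x Ω X (Jp Y)) (J.val (ι x) u)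
            + 3 * g.val (ι x) (S.radicalForm x Ω Y (Jp X)) u
          = g.val (ι x) (S.radicalForm x Ω Y (Jp X)) (J.val (ι x) u)
            + 3 * g.val (ι x) (S.radicalForm x Ω X (Jp Y)) u) ∧
      (∀ z ∈ S.Bprime x,
        g.val (ι x) (S.screenConnection x Ω X (Jp Y)) (S.f x J z)
            + g.val (ι x) (S.screenSecondForm x Ω X (Jp Y)) (J.val (ι x) z)
            + 3 * g.val (ι x) (S.screenConnection x Ω Y (Jp X)) z
          = g.val (ι x) (S.screenConnection x Ω Y (Jp X)) (S.f x J z)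
            + g.val (ι x) (S.screenSecondForm x Ω Y (Jp X)) (J.val (ι x) z)
            + 3 * g.val (ι x) (S.screenConnection x Ω X (Jp Y)) z) := by
  intro Ω Jp
  obtain ⟨β, hβ, hsub⟩ := S.exists_covAlong_lmConnection_pushJ_sub_eq hD hJ η l m hX hY x
  have htan : push E ι (VectorField.mlieBracket 𝓘(ℝ, F) X Y) x ∈ tangent E F ι x :=
    LinearMap.mem_range_self _ _
  have hradical : S.radicalPart x (S.tangentPart x
        (covAlong Ω ι (Jp Y) x (X x) - covAlong Ω ι (Jp X) x (Y x)))
      = S.radicalForm x Ω X (Jp Y) - S.radicalForm x Ω Y (Jp X) := by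
    rw [map_sub, map_sub]; rfl
  have hscreen : S.screenPart x (S.tangentPart x
        (covAlong Ω ι (Jp Y) x (X x) - covAlong Ω ι (Jp X) x (Y x)))
      = S.screenConnection x Ω X (Jp Y) - S.screenConnection x Ω Y (Jp X) := by
    rw [map_sub, map_sub]; rfl
  have hscreenTrans : S.screenTransPart x
        (covAlong Ω ι (Jp Y) x (X x) - covAlong Ω ι (Jp X) x (Y x))
      = S.screenSecondForm x Ω X (Jp Y) - S.screenSecondForm x Ω Y (Jp X) :=
    map_sub _ _ _
  rw [S.mem_B₀_iff htan hβ hsub, hradical, hscreen, hscreenTrans]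
  simp only [map_sub, sub_apply]
  refine and_congr (forall₂_congr fun u _ ↦ ?_) (forall₂_congr fun z _ ↦ ?_) <;>
    constructor <;> intro h <;> linarith

end ScreenGenericLightlikeSubmanifold

end Bracket

end Bronze

end

theorem mainTheorem4_general
    {E : Type*} [NormedAddCommGroup E] [NormedSpace ℝ E] [FiniteDimensional ℝ E]
    {N : Type*} [TopologicalSpace N] [ChartedSpace E N] [IsManifold 𝓘(ℝ, E) ∞ N]
    {F : Type*} [NormedAddCommGroup F] [NormedSpace ℝ F] [FiniteDimensional ℝ F]
    {M : Type*} [TopologicalSpace M] [T2Space M] [ChartedSpace F M] [IsManifold 𝓘(ℝ, F) ∞ M]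
    (g : Bronze.SemiRiemannianMetric E N) (J : Bronze.BronzeStructure g)
    (D : Bronze.LinearConnection E N) (hD : D.torsion = 0)
    (hJ : Bronze.IsParallel D J)
    (η : ∀ p : N, TangentSpace 𝓘(ℝ, E) p)
    (l m : N → ℝ) (ι : M → N) (S : Bronze.ScreenGenericLightlikeSubmanifold F g J ι) :
    let Ω := Bronze.lmConnection g J D η l m
    let Jp := Bronze.pushJ (F := F) J ι
    Bronze.IsIntegrable F ι (S.B₀ J) ↔
      (∀ X Y : ∀ x : M, TangentSpace 𝓘(ℝ, F) x,
        Bronze.IsTangentSection ι (S.B₀ J) X → Bronze.IsTangentSection ι (S.B₀ J) Y →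
        ∀ U, Bronze.IsSection F ι S.ltr U → ∀ x,
          g.val (ι x) (S.radicalForm x Ω X (Jp Y)) (J.val (ι x) (U x))
              + 3 * g.val (ι x) (S.radicalForm x Ω Y (Jp X)) (U x)
            = g.val (ι x) (S.radicalForm x Ω Y (Jp X)) (J.val (ι x) (U x))
              + 3 * g.val (ι x) (S.radicalForm x Ω X (Jp Y)) (U x)) ∧
      (∀ X Y : ∀ x : M, TangentSpace 𝓘(ℝ, F) x,
        Bronze.IsTangentSection ι (S.B₀ J) X → Bronze.IsTangentSection ι (S.B₀ J) Y →
        ∀ Z, Bronze.IsSection F ι S.Bprime Z → ∀ x,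
          g.val (ι x) (S.screenConnection x Ω X (Jp Y)) (S.f x J (Z x))
              + g.val (ι x) (S.screenSecondForm x Ω X (Jp Y)) (J.val (ι x) (Z x))
              + 3 * g.val (ι x) (S.screenConnection x Ω Y (Jp X)) (Z x)
            = g.val (ι x) (S.screenConnection x Ω Y (Jp X)) (S.f x J (Z x))
              + g.val (ι x) (S.screenSecondForm x Ω Y (Jp X)) (J.val (ι x) (Z x))
              + 3 * g.val (ι x) (S.screenConnection x Ω X (Jp Y)) (Z x)) := by
  have hι : CMDiff ∞ ι := S.isImmersion.contMDiff
  have hiff {X Y : ∀ x : M, TangentSpace 𝓘(ℝ, F) x} (hX : Bronze.IsTangentSection ι (S.B₀ J) X)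
      (hY : Bronze.IsTangentSection ι (S.B₀ J) Y) (x : M) :=
    S.push_mlieBracket_mem_B₀_iff hD hJ η l m hX hY x
  refine ⟨fun h ↦ ⟨fun X Y hX hY U hU x ↦ ?_, fun X Y hX hY Z hZ x ↦ ?_⟩, ?_⟩
  · exact ((hiff hX hY x).1 (h X Y hX hY x)).1 _ (hU.2 x)
  · exact ((hiff hX hY x).1 (h X Y hX hY x)).2 _ (hZ.2 x)
  · rintro ⟨hradical, hscreen⟩ X Y hX hY x
    refine (hiff hX hY x).2 ⟨fun u hu ↦ ?_, fun z hz ↦ ?_⟩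
    · obtain ⟨U, hU, rfl⟩ := Bronze.exists_isSection_apply_eq hι S.ltr_subbundle hu
      exact hradical X Y hX hY U hU x
    · obtain ⟨k, hBprime⟩ := S.Bprime_subbundle
      obtain ⟨Z, hZ, rfl⟩ := Bronze.exists_isSection_apply_eq hι hBprime hz
      exact hscreen X Y hX hY Z hZ x

theorem mainTheorem4
    -- the ambient manifold `N` and the submanifold `M`, immersed by `ι`
    {E : Type*} [NormedAddCommGroup E] [NormedSpace ℝ E] [FiniteDimensional ℝ E]
    {N : Type*} [TopologicalSpace N] [T2Space N] [ChartedSpace E N] [IsManifold 𝓘(ℝ, E) ∞ N]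
    {F : Type*} [NormedAddCommGroup F] [NormedSpace ℝ F] [FiniteDimensional ℝ F]
    {M : Type*} [TopologicalSpace M] [T2Space M] [ChartedSpace F M] [IsManifold 𝓘(ℝ, F) ∞ M]
    -- the locally bronze semi-Riemannian structure, with Levi-Civita connection `D`
    (g : Bronze.SemiRiemannianMetric E N) (J : Bronze.BronzeStructure g)
    (D : Bronze.LinearConnection E N) (hD : Bronze.IsLeviCivita g D)
    (hJ : Bronze.IsParallel D J)
    -- the data of the `(l, m)`-type connection
    (η : ∀ p : N, TangentSpace 𝓘(ℝ, E) p)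
    (hη : ContMDiff 𝓘(ℝ, E) 𝓘(ℝ, E).tangent ∞
      (fun p ↦ (⟨p, η p⟩ : TangentBundle 𝓘(ℝ, E) N)))
    (hη_unit : ∀ p, g.val p (η p) (η p) = 1)
    (l m : N → ℝ) (hl : ContMDiff 𝓘(ℝ, E) 𝓘(ℝ) ∞ l) (hm : ContMDiff 𝓘(ℝ, E) 𝓘(ℝ) ∞ m)
    (hlm : (l, m) ≠ (0, 0))
    -- the screen generic lightlike submanifold
    (ι : M → N) (S : Bronze.ScreenGenericLightlikeSubmanifold F g J ι) :
    let Ω := Bronze.lmConnection g J D η l m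
    let Jp := Bronze.pushJ (F := F) J ι
    Bronze.IsIntegrable F ι (S.B₀ J) ↔
      (∀ X Y : ∀ x : M, TangentSpace 𝓘(ℝ, F) x,
        Bronze.IsTangentSection ι (S.B₀ J) X → Bronze.IsTangentSection ι (S.B₀ J) Y →
        ∀ U, Bronze.IsSection F ι S.ltr U → ∀ x,
          g.val (ι x) (S.radicalForm x Ω X (Jp Y)) (J.val (ι x) (U x))
              + 3 * g.val (ι x) (S.radicalForm x Ω Y (Jp X)) (U x)
            = g.val (ι x) (S.radicalForm x Ω Y (Jp X)) (J.val (ι x) (U x))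
              + 3 * g.val (ι x) (S.radicalForm x Ω X (Jp Y)) (U x)) ∧
      (∀ X Y : ∀ x : M, TangentSpace 𝓘(ℝ, F) x,
        Bronze.IsTangentSection ι (S.B₀ J) X → Bronze.IsTangentSection ι (S.B₀ J) Y →
        ∀ Z, Bronze.IsSection F ι S.Bprime Z → ∀ x,
          g.val (ι x) (S.screenConnection x Ω X (Jp Y)) (S.f x J (Z x))
              + g.val (ι x) (S.screenSecondForm x Ω X (Jp Y)) (J.val (ι x) (Z x))
              + 3 * g.val (ι x) (S.screenConnection x Ω Y (Jp X)) (Z x)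
            = g.val (ι x) (S.screenConnection x Ω Y (Jp X)) (S.f x J (Z x))
              + g.val (ι x) (S.screenSecondForm x Ω Y (Jp X)) (J.val (ι x) (Z x))
              + 3 * g.val (ι x) (S.screenConnection x Ω X (Jp Y)) (Z x)) :=
  mainTheorem4_general g J D hD.torsion_free hJ η l m ι S
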